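/- **Setting.** Let $X\in\mathbb R^{d\times n}$ have linearly independent rows (so $1\le d\le n$), with largest and smallest singular values $\sigma_{\max}(X)\ge\sigma_{\min}(X)>0$ and $\kappa(X)=\sigma_{\max}(X)/\sigma_{\min}(X)$. Let $m\le n$, let $W^\star\in\mathbb R^{m\times d}$ have rank $r^\star$ and singular values $\sigma_1(W^\star)\ge\sigma_2(W^\star)\ge\cdots$, and let $Y=W^\star X+\mathcal E$, where $\mathcal E\in\mathbb R^{m\times n}$ has i.i.d. $\mathcal N(0,\varepsilon^2)$ entries, $\varepsilon\ge 0$. Let $\sigma_1^\star\ge\sigma_2^\star\ge\cdots\ge 0$ be the singular values of $Y$ (extended by zeros), and for a target rank $r\ge1$ put $$\mathcal T_k^\star=\min\Big\{\min_{j>k}|\sigma_k^\star-\sigma_j^\star|,\ \sigma_k^\star\Big\},\qquad \mathcal T_{\min}^\star=\min_{1\le k\le r}\mathcal T_k^\star .$$ **Algorithm.** Set $Y_1=Y$; for $k=1,\dots,r$ an arbitrary subroutine returns $(a_k,b_k)=\texttt{rank-1}(Y_k,X,t)\in\mathbb R^d\times\mathbb R^m$, and $Y_{k+1}=Y_k-b_ka_k^\top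 X$. Let $(\bar a_k,\bar b_k)$ be any minimizer of $\tfrac12\|Y_k-ba^\top X\|_F^2$ over $a\in\mathbb R^d$, $b\in\mathbb R^m$, and let $\delta_k=b_ka_k^\top-\bar b_k\bar a_k^\top$ be the numerical error of step $k$. **Theorem.** There is an absolute constant $c>0$, and for every $\gamma_0<1$ a constant $C>0$ depending only on $\gamma_0$, such that for all data as above and every $\gamma\in(0,\gamma_0]$ the following holds with probability at least $1-\gamma$, simultaneously for all choices of the subroutine: if $\mathcal T_{\min}^\star>0$ and $$\varepsilon\le c\,\frac{\mathcal T_{\min}^\star}{\sqrt n+\sqrt{\log(1/\gamma)}},$$ then $$\Big\|W^\star-\sum_{k=1}^r b_ka_k^\top\Big\|_F\le \kappa(X)\Big(\sum_{k=r+1}^{r^\star}\sigma_k(W^\star)+\sum_{k=1}^r\sum_{k'=1}^{k}\|\delta_{k'}\|_F\prod_{j=k'+1}^{k}\Big(2+\frac{6\sigma_j^\star}{\mathcal T_k^\star}\Big)\Big)+C\,\frac{\varepsilon\sqrt{n\log(1/\gamma)}}{\sigma_{\min}(X)}\Big(r+\sqrt{\frac{\min\{r^\star,r\}}{\mathcal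 T_{\min}^\star}}\Big).$$ -/

import Mathlib

open MeasureTheory ProbabilityTheory
open scoped NNReal Matrix.Norms.Frobenius

/-! All indices are zero-based: index `k` here is the index `k + 1` of the usual one-based
numbering of singular values and of algorithm steps. Matrix norms `‖·‖` are Frobenius norms. -/

namespace SeqLowRank

noncomputable section

/-- The `k`-th largest singular value of a real matrix (zero-based, with multiplicity);
it vanishes for `k ≥ rank A`. -/
def sv {p q : ℕ} (A : Matrix (Fin p) (Fin q) ℝ) (k : ℕ) : ℝ :=
  (Matrix.toEuclideanLin A).singularValues k

/-- The largest singular value. -/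
def sigmaMax {p q : ℕ} (A : Matrix (Fin p) (Fin q) ℝ) : ℝ := sv A 0

/-- The smallest singular value of a `p × q` matrix with `p ≤ q`, i.e. the `p`-th largest one.
It is positive iff `p ≥ 1` and the rows are linearly independent. -/
def sigmaMin {p q : ℕ} (A : Matrix (Fin p) (Fin q) ℝ) : ℝ := sv A (p - 1)

/-- The condition number `σ_max / σ_min`. -/
def cond {p q : ℕ} (A : Matrix (Fin p) (Fin q) ℝ) : ℝ := sigmaMax A / sigmaMin A

/-- The singular value gap `min {min_{j > k} |σ_k - σ_j|, σ_k}` of a matrix. -/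
def gap {p q : ℕ} (Y : Matrix (Fin p) (Fin q) ℝ) (k : ℕ) : ℝ :=
  min (⨅ j : {j : ℕ // k < j}, |sv Y k - sv Y j|) (sv Y k)

/-- The minimum of the gaps of the first `r` singular values (meaningful for `r ≥ 1`). -/
def gapMin {p q : ℕ} (Y : Matrix (Fin p) (Fin q) ℝ) (r : ℕ) : ℝ :=
  ⨅ k : Fin r, gap Y k

variable {m d n : ℕ}

/-- A subroutine `rank-1 (Y, X, t)` returning a pair `(a, b)` of vectors. -/
abbrev Rank1Routine (m d n : ℕ) : Type :=
  Matrix (Fin m) (Fin n) ℝ → Matrix (Fin d) (Fin n) ℝ → ℕ → (Fin d → ℝ) × (Fin m → ℝ)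

/-- The rank-one coefficient matrix `b aᵀ` of a pair `(a, b)`. -/
def outer (ab : (Fin d → ℝ) × (Fin m → ℝ)) : Matrix (Fin m) (Fin d) ℝ :=
  Matrix.vecMulVec ab.2 ab.1

/-- The deflated label matrices of the inexact sequential algorithm: start from `Y`, and at each
step subtract `b_k a_kᵀ X`, where `(a_k, b_k)` is what the subroutine returns on the current label
matrix. The subroutine may change from step to step (other seeds, other initializations). -/
def deflated (rank1 : ℕ → Rank1Routine m d n) (X : Matrix (Fin d) (Fin n) ℝ) (t : ℕ)
    (Y : Matrix (Fin m) (Fin n) ℝ) : ℕ → Matrix (Fin m) (Fin n) ℝ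
  | 0 => Y
  | k + 1 => deflated rank1 X t Y k - outer (rank1 k (deflated rank1 X t Y k) X t) * X

/-- The pair `(a_k, b_k)` returned by the inexact sequential algorithm at step `k`. -/
def output (rank1 : ℕ → Rank1Routine m d n) (X : Matrix (Fin d) (Fin n) ℝ) (t : ℕ)
    (Y : Matrix (Fin m) (Fin n) ℝ) (k : ℕ) : (Fin d → ℝ) × (Fin m → ℝ) :=
  rank1 k (deflated rank1 X t Y k) X t

/-- `(a, b)` is an exact solution of the rank-one problem: it minimizes
`½ ‖Y - b aᵀ X‖_F²` over all pairs of vectors. -/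
def IsExactRank1 (X : Matrix (Fin d) (Fin n) ℝ) (Y : Matrix (Fin m) (Fin n) ℝ)
    (ab : (Fin d → ℝ) × (Fin m → ℝ)) : Prop :=
  ∀ ab' : (Fin d → ℝ) × (Fin m → ℝ),
    1 / 2 * ‖Y - outer ab * X‖ ^ 2 ≤ 1 / 2 * ‖Y - outer ab' * X‖ ^ 2

/-- The accumulated numerical error of `r` steps: with `e k` the Frobenius norm of the numerical
error `δ_k`, the sum over `k` and `k' ≤ k` of `e k' ∏_{k' < j ≤ k} (2 + 6 σ_j(Y) / gap_k(Y))`. -/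
def accumulatedError (Y : Matrix (Fin m) (Fin n) ℝ) (e : ℕ → ℝ) (r : ℕ) : ℝ :=
  ∑ k ∈ Finset.range r, ∑ k' ∈ Finset.range (k + 1),
    e k' * ∏ j ∈ Finset.Ioc k' k, (2 + 6 * sv Y j / gap Y k)

end

end SeqLowRank

/-! Everything is deterministic except one bound on the operator norm of the noise, `η` of order `ε
√(n log (1/γ))`.

Let `P` be the orthogonal projection onto the row space of `X`. By Pythagoras, an exact rank-one fit
to `Y_k` is a best rank-one approximation of `A_k = Y_k P`. Removing it multiplies `A_k` on both
sides by contractions `Q_k`, `Q'_k`, each within rank one of the identity, and shifts the singular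
values by one (`IsBestRankOne.exists_compression`). Hence `A_{k+1} = Q_k A_k Q'_k - Δ_k` with `Δ_k =
δ_k X` and `A_0 = W X + E P`. No perturbation theory of singular vectors is needed.

Apply the same compressions to `M = W X` and to the noise `E P`, giving `N_k` and `F_k`.
Contractivity gives `‖N_k + F_k - A_k‖ ≤ G_k`, the sum of the earlier `‖Δ_l‖`. The compressions
change the noise by a matrix of rank at most `2r` and operator norm at most `2η`, which costs only
`O(r η)` in Frobenius norm. For `N_r`, Weyl's inequality and the shift give `σ_{i+j}(N_r) ≤
σ_{r+i}(M) + H_j` for every `j ≤ r`, with `H_r = 0`. A counting argument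
(`exists_sum_sq_le_of_le_add`) then bounds `‖N_r‖` by the tail sum of `M` plus a multiple of the sum
of `H`, with no dimension factor (`frobenius_inexact_deflation_le`).

Finally `A_r - E P = (W - ∑ b_k a_kᵀ) X`, and a right inverse of `X` of norm at most `1/σ_min`
removes `X`. The numerical errors have collected only the weight `7`, while every nonempty product
in the stated bound is at least `8` (`le_accumulatedError`). -/

namespace LinearMap

/-! ### Min-max estimates for singular values of linear maps. -/

open Module

variable {E F : Type*} [NormedAddCommGroup E] [InnerProductSpace ℝ E] [FiniteDimensional ℝ E]
  [NormedAddCommGroup F] [InnerProductSpace ℝ F] [FiniteDimensional ℝ F]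

/-- Spectral expansion of `‖T x‖²` in an orthonormal basis of right singular vectors. -/
theorem norm_apply_sq_eq_sum_singularValues (T : E →ₗ[ℝ] F) (x : E) :
    ‖T x‖ ^ 2 = ∑ i : Fin (finrank ℝ E), T.singularValues i ^ 2 *
      (T.isSymmetric_adjoint_comp_self.eigenvectorBasis rfl).repr x i ^ 2 := by
  set b := T.isSymmetric_adjoint_comp_self.eigenvectorBasis (n := finrank ℝ E) rfl
  have h1 : ‖T x‖ ^ 2 = inner ℝ x ((adjoint T ∘ₗ T) x) := by
    rw [comp_apply, adjoint_inner_right, real_inner_self_eq_norm_sq]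
  rw [h1, ← b.repr.inner_map_map, PiLp.inner_apply]
  refine Finset.sum_congr rfl fun i _ => ?_
  rw [T.isSymmetric_adjoint_comp_self.eigenvectorBasis_apply_self_apply,
    T.sq_singularValues_fin rfl]
  simp only [RCLike.inner_apply, conj_trivial, RCLike.ofReal_real_eq_id, id_eq]
  ring

/-- A subspace of dimension `k + 1` on which `T` expands norms by at least its `k`-th singular
value. -/
theorem exists_submodule_singularValues_mul_norm_le (T : E →ₗ[ℝ] F) {k : ℕ}
    (hk : k < finrank ℝ E) :
    ∃ V : Submodule ℝ E, finrank ℝ V = k + 1 ∧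
      ∀ x ∈ V, T.singularValues k * ‖x‖ ≤ ‖T x‖ := by
  set b := T.isSymmetric_adjoint_comp_self.eigenvectorBasis (n := finrank ℝ E) rfl
  let f : Fin (k + 1) → E := fun i => b (Fin.castLE hk i)
  have hf : LinearIndependent ℝ f :=
    b.orthonormal.linearIndependent.comp _ (Fin.castLE_injective hk)
  refine ⟨Submodule.span ℝ (Set.range f), by simpa using finrank_span_eq_card hf, ?_⟩
  intro x hx
  have hz : ∀ i : Fin (finrank ℝ E), k < i → b.repr x i = 0 := by
    intro i hi
    induction hx using Submodule.span_induction with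
    | mem y hy =>
      obtain ⟨j, rfl⟩ := hy
      have : Fin.castLE hk j ≠ i := by
        intro h
        have := congrArg Fin.val h
        simp at this
        omega
      simp [f, this.symm]
    | zero => simp
    | add y z _ _ hy hz => simp [hy, hz]
    | smul a y _ hy => simp [hy]
  refine le_of_sq_le_sq ?_ (norm_nonneg _)
  rw [mul_pow, norm_apply_sq_eq_sum_singularValues, ← b.repr.norm_map x, EuclideanSpace.norm_sq_eq,
    Finset.mul_sum]
  refine Finset.sum_le_sum fun i _ => ?_
  by_cases hi : k < (i : ℕ)
  · have := hz i hi
    simp [b] at this ⊢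
    simp [this]
  · rw [Real.norm_eq_abs, sq_abs]
    gcongr
    · exact T.singularValues_nonneg k
    · exact T.singularValues_antitone (not_lt.1 hi)

/-- A subspace of codimension `k` on which `T` expands norms by at most its `k`-th singular
value. -/
theorem exists_submodule_norm_le_singularValues_mul (T : E →ₗ[ℝ] F) {k : ℕ} :
    ∃ W : Submodule ℝ E, finrank ℝ E ≤ finrank ℝ W + k ∧
      ∀ x ∈ W, ‖T x‖ ≤ T.singularValues k * ‖x‖ := by
  set b := T.isSymmetric_adjoint_comp_self.eigenvectorBasis (n := finrank ℝ E) rfl with hb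
  let g : E →ₗ[ℝ] (Fin k → ℝ) :=
    LinearMap.pi fun i => if h : (i : ℕ) < finrank ℝ E then
      (innerₛₗ ℝ (b ⟨i, h⟩)) else 0
  refine ⟨ker g, ?_, ?_⟩
  · have h1 := g.finrank_range_add_finrank_ker
    have h2 : finrank ℝ (range g) ≤ k := by
      simpa using Submodule.finrank_le (range g)
    omega
  · intro x hx
    have hz : ∀ i : Fin (finrank ℝ E), (i : ℕ) < k → b.repr x i = 0 := by
      intro i hi
      have := congrFun (mem_ker.1 hx) ⟨i, hi⟩
      simpa [g, b.repr_apply_apply] using this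
    refine le_of_sq_le_sq ?_ (mul_nonneg (T.singularValues_nonneg k) (norm_nonneg _))
    rw [mul_pow, norm_apply_sq_eq_sum_singularValues, ← b.repr.norm_map x,
      EuclideanSpace.norm_sq_eq, Finset.mul_sum]
    refine Finset.sum_le_sum fun i _ => ?_
    by_cases hi : (i : ℕ) < k
    · have := hz i hi
      rw [← hb, this]
      simp
    · rw [Real.norm_eq_abs, sq_abs]
      gcongr
      · exact T.singularValues_nonneg _
      · exact T.singularValues_antitone (not_lt.1 hi)

theorem norm_apply_le_singularValues_zero (T : E →ₗ[ℝ] F) (x : E) :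
    ‖T x‖ ≤ T.singularValues 0 * ‖x‖ := by
  obtain ⟨W, hW, h⟩ := T.exists_submodule_norm_le_singularValues_mul (k := 0)
  have : W = ⊤ := Submodule.eq_top_of_finrank_eq (le_antisymm (Submodule.finrank_le W) hW)
  exact h x (this ▸ Submodule.mem_top)

/-- By dimension count, `V` meets the subspace of codimension `k` on which `T` expands by at most
its `k`-th singular value; compare the two bounds at a nonzero common vector. -/
theorem le_singularValues_of_submodule (T : E →ₗ[ℝ] F) {k : ℕ} {s : ℝ} (V : Submodule ℝ E)
    (hV : k + 1 ≤ finrank ℝ V) (h : ∀ x ∈ V, s * ‖x‖ ≤ ‖T x‖) : s ≤ T.singularValues k := by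
  obtain ⟨W, hW, h'⟩ := T.exists_submodule_norm_le_singularValues_mul (k := k)
  have hpos : 0 < finrank ℝ (V ⊓ W : Submodule ℝ E) := by
    have h1 := Submodule.finrank_sup_add_finrank_inf_eq V W
    have h2 := Submodule.finrank_le (V ⊔ W)
    omega
  have : Nontrivial (V ⊓ W : Submodule ℝ E) := finrank_pos_iff.1 hpos
  obtain ⟨⟨x, hx⟩, hx0⟩ := exists_ne (0 : (V ⊓ W : Submodule ℝ E))
  have hx0 : 0 < ‖x‖ := norm_pos_iff.2 fun hh => hx0 (Subtype.ext hh)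
  exact le_of_mul_le_mul_right ((h x hx.1).trans (h' x hx.2)) hx0

/-- To bound a singular value it suffices to bound it when it is positive, in which case a subspace
of expansion is available. -/
theorem singularValues_le_of_forall_submodule (T : E →ₗ[ℝ] F) {k : ℕ} {t : ℝ} (ht : 0 ≤ t)
    (h : ∀ V : Submodule ℝ E, 0 < T.singularValues k → finrank ℝ V = k + 1 →
      (∀ x ∈ V, T.singularValues k * ‖x‖ ≤ ‖T x‖) → T.singularValues k ≤ t) :
    T.singularValues k ≤ t := by
  rcases (T.singularValues_nonneg k).eq_or_lt with h0 | h0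
  · rwa [← h0]
  · have hk : k < finrank ℝ E := by
      by_contra hk
      rw [T.singularValues_of_finrank_le (not_lt.1 hk)] at h0
      exact h0.false
    obtain ⟨V, hV, hVT⟩ := T.exists_submodule_singularValues_mul_norm_le hk
    exact h V h0 hV hVT

/-- The Weyl inequality. -/
theorem singularValues_add_le (S T : E →ₗ[ℝ] F) {k : ℕ} {c : ℝ} (hc : 0 ≤ c)
    (hT : ∀ x, ‖T x‖ ≤ c * ‖x‖) : (S + T).singularValues k ≤ S.singularValues k + c := by
  refine singularValues_le_of_forall_submodule _ (add_nonneg (S.singularValues_nonneg k) hc) ?_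
  intro V _ hV h
  rw [← sub_le_iff_le_add]
  refine S.le_singularValues_of_submodule V hV.ge fun x hx => ?_
  have h1 := h x hx
  have h2 := norm_add_le (S x) (T x)
  rw [add_apply] at h1
  linarith [hT x]

theorem singularValues_le_of_norm_le (T : E →ₗ[ℝ] F) {k : ℕ} {c : ℝ} (hc : 0 ≤ c)
    (hT : ∀ x, ‖T x‖ ≤ c * ‖x‖) : T.singularValues k ≤ c := by
  simpa using singularValues_add_le (0 : E →ₗ[ℝ] F) T (k := k) hc hT

section comp

variable {H : Type*} [NormedAddCommGroup H] [InnerProductSpace ℝ H] [FiniteDimensional ℝ H]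

theorem singularValues_comp_le_mul (S : F →ₗ[ℝ] H) (T : E →ₗ[ℝ] F) {k : ℕ} {c : ℝ} (hc : 0 ≤ c)
    (hS : ∀ x, ‖S x‖ ≤ c * ‖x‖) : (S ∘ₗ T).singularValues k ≤ c * T.singularValues k := by
  refine singularValues_le_of_forall_submodule _ (mul_nonneg hc (T.singularValues_nonneg k)) ?_
  intro V h0 hV h
  have hc : 0 < c := by
    refine hc.lt_of_ne' fun hc => ?_
    have : Nontrivial V := finrank_pos_iff (R := ℝ).1 (by omega)
    obtain ⟨⟨x, hx⟩, hx0⟩ := exists_ne (0 : V)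
    have hx0 : 0 < ‖x‖ := norm_pos_iff.2 fun hh => hx0 (Subtype.ext hh)
    have h1 := h x hx
    have h2 := hS (T x)
    rw [hc, zero_mul] at h2
    have := mul_pos h0 hx0
    exact absurd (h1.trans h2) (not_le.2 this)
  rw [← div_le_iff₀' hc]
  refine T.le_singularValues_of_submodule V hV.ge fun x hx => ?_
  rw [div_mul_eq_mul_div, div_le_iff₀' hc]
  exact (h x hx).trans (hS _)

/-- A subspace on which `S ∘ₗ T` expands by a positive factor is mapped injectively by `T`, so its
image has the same dimension and tests `S`. -/
theorem singularValues_comp_le_mul' (S : F →ₗ[ℝ] H) (T : E →ₗ[ℝ] F) {k : ℕ} {c : ℝ} (hc : 0 ≤ c)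
    (hT : ∀ x, ‖T x‖ ≤ c * ‖x‖) : (S ∘ₗ T).singularValues k ≤ c * S.singularValues k := by
  refine singularValues_le_of_forall_submodule _ (mul_nonneg hc (S.singularValues_nonneg k)) ?_
  intro V h0 hV h
  have hinj : ∀ x ∈ V, T x = 0 → x = 0 := by
    intro x hx hTx
    have h1 := h x hx
    rw [comp_apply, hTx, map_zero, norm_zero] at h1
    by_contra hx0
    exact absurd h1 (not_le.2 (mul_pos h0 (norm_pos_iff.2 hx0)))
  have hc : 0 < c := by
    refine hc.lt_of_ne' fun hc => ?_
    have : Nontrivial V := finrank_pos_iff (R := ℝ).1 (by omega)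
    obtain ⟨⟨x, hx⟩, hx0⟩ := exists_ne (0 : V)
    refine hx0 (Subtype.ext (hinj x hx ?_))
    have := hT x
    rw [hc, zero_mul] at this
    exact norm_le_zero_iff.1 this
  rw [← div_le_iff₀' hc]
  refine S.le_singularValues_of_submodule (V.map T) ?_ ?_
  · rw [← hV]
    have := (Submodule.equivMapOfInjective (T.domRestrict V) (by
      rw [← ker_eq_bot, ker_eq_bot']
      rintro ⟨x, hx⟩ hh
      exact Subtype.ext (hinj x hx hh)) ⊤).finrank_eq
    rw [finrank_top] at this
    rw [this]
    refine le_of_eq ?_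
    congr 1
    all_goals
      rw [Submodule.map_top, range_domRestrict]
  · rintro _ ⟨x, hx, rfl⟩
    rw [div_mul_eq_mul_div, div_le_iff₀' hc]
    calc _ ≤ (S ∘ₗ T).singularValues k * (c * ‖x‖) := by gcongr; exact hT x
      _ = c * ((S ∘ₗ T).singularValues k * ‖x‖) := by ring
      _ ≤ _ := by gcongr; exact h x hx

end comp

end LinearMap

/-! ### Deflation by a top singular component. -/

namespace LinearMap

open Module

variable {E F : Type*} [NormedAddCommGroup E] [InnerProductSpace ℝ E] [FiniteDimensional ℝ E]
  [NormedAddCommGroup F] [InnerProductSpace ℝ F] [FiniteDimensional ℝ F]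

/-- Deflating a top singular component shifts the singular values. -/
theorem singularValues_deflation_le (T R : E →ₗ[ℝ] F) {v : E} {b : F} (hv : ‖v‖ = 1)
    (hTR : ∀ x, T x = R x + inner ℝ v x • b) (hRv : R v = 0) (hb : ∀ x, inner ℝ (R x) b = 0)
    (hT : ∀ x, ‖T x‖ ≤ ‖b‖ * ‖x‖) (k : ℕ) : R.singularValues k ≤ T.singularValues (k + 1) := by
  refine singularValues_le_of_forall_submodule _ (T.singularValues_nonneg _) ?_
  intro V h0 hV h
  set s := R.singularValues k
  have hvv : inner ℝ v v = (1 : ℝ) := by rw [real_inner_self_eq_norm_sq, hv, one_pow]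
  have hvV : v ∉ V := fun hmem => by
    have := h v hmem
    rw [hRv, norm_zero, hv, mul_one] at this
    exact absurd this (not_le.2 h0)
  have hproj : ∀ x, ‖x - inner ℝ v x • v‖ ^ 2 = ‖x‖ ^ 2 - inner ℝ v x ^ 2 := by
    intro x
    rw [norm_sub_sq_real, norm_smul, inner_smul_right, real_inner_comm, hv, mul_one,
      Real.norm_eq_abs, sq_abs]
    ring
  -- `R x` equals `T` applied to the component of `x` orthogonal to `v`, so `R` is also bounded by
  -- `‖b‖`.
  have hsb : s ≤ ‖b‖ := by
    have : Nontrivial V := finrank_pos_iff (R := ℝ).1 (by omega)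
    obtain ⟨⟨x, hx⟩, hx0⟩ := exists_ne (0 : V)
    have hx0 : 0 < ‖x‖ := norm_pos_iff.2 fun hh => hx0 (Subtype.ext hh)
    refine le_of_mul_le_mul_right ((h x hx).trans ?_) hx0
    have h1 := hT (x - inner ℝ v x • v)
    rw [hTR, map_sub, map_smul, hRv, smul_zero, sub_zero, inner_sub_right, inner_smul_right, hvv,
      mul_one, sub_self, zero_smul, add_zero] at h1
    refine h1.trans (mul_le_mul_of_nonneg_left ?_ (norm_nonneg _))
    refine le_of_sq_le_sq ?_ (norm_nonneg _)
    rw [hproj]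
    linarith [sq_nonneg (inner ℝ v x)]
  -- Adjoining `v` raises the dimension by one. Expansion by `s` survives because `R x` is
  -- orthogonal to `b` and `T v = b` has norm at least `s`.
  refine T.le_singularValues_of_submodule (V ⊔ Submodule.span ℝ {v}) ?_ ?_
  · have h1 := Submodule.finrank_sup_add_finrank_inf_eq V (Submodule.span ℝ {v})
    have hv0 : v ≠ 0 := fun h => by simp [h] at hv
    have h2 : V ⊓ Submodule.span ℝ {v} = ⊥ :=
      ((Submodule.disjoint_span_singleton' hv0).2 hvV).eq_bot
    rw [h2, finrank_bot, finrank_span_singleton hv0] at h1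
    omega
  · intro z hz
    obtain ⟨x, hx, y, hy, rfl⟩ := Submodule.mem_sup.1 hz
    obtain ⟨c, rfl⟩ := Submodule.mem_span_singleton.1 hy
    refine le_of_sq_le_sq ?_ (norm_nonneg _)
    have h1 : ‖T (x + c • v)‖ ^ 2 = ‖R x‖ ^ 2 + (inner ℝ v x + c) ^ 2 * ‖b‖ ^ 2 := by
      rw [hTR, map_add, map_smul, hRv, smul_zero, add_zero, norm_add_sq_real, inner_smul_right,
        hb, norm_smul, inner_add_right, inner_smul_right, hvv, Real.norm_eq_abs, mul_pow, sq_abs]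
      ring
    have h2 : ‖x + c • v‖ ^ 2 = ‖x‖ ^ 2 + 2 * c * inner ℝ v x + c ^ 2 := by
      rw [norm_add_sq_real, norm_smul, inner_smul_right, real_inner_comm, hv, mul_one,
        Real.norm_eq_abs, sq_abs]
      ring
    have h3 : s ^ 2 * ‖x‖ ^ 2 ≤ ‖R x‖ ^ 2 := by
      rw [← mul_pow]
      have := h x hx
      gcongr
    have h4 : s ^ 2 ≤ ‖b‖ ^ 2 := by gcongr
    rw [mul_pow, h1, h2]
    nlinarith [mul_le_mul_of_nonneg_left h4 (sq_nonneg (inner ℝ v x + c)),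
      mul_nonneg (sq_nonneg s) (sq_nonneg (inner ℝ v x))]

end LinearMap

/-! ### Singular values and Frobenius norms of matrices. -/

namespace SeqLowRank

open Module Matrix

variable {p q l : ℕ}

theorem toEuclideanLin_mul (A : Matrix (Fin p) (Fin q) ℝ) (B : Matrix (Fin q) (Fin l) ℝ) :
    (A * B).toEuclideanLin = A.toEuclideanLin ∘ₗ B.toEuclideanLin := by
  ext x : 1
  simp [toLpLin_apply]

theorem sv_nonneg (A : Matrix (Fin p) (Fin q) ℝ) (k : ℕ) : 0 ≤ sv A k :=
  LinearMap.singularValues_nonneg _ k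

theorem sv_antitone (A : Matrix (Fin p) (Fin q) ℝ) : Antitone (sv A) :=
  LinearMap.singularValues_antitone _

theorem sv_eq_zero_of_rank_le (A : Matrix (Fin p) (Fin q) ℝ) {k : ℕ} (h : A.rank ≤ k) :
    sv A k = 0 := by
  rw [sv, LinearMap.singularValues_eq_zero_iff_le_finrank_range]
  refine le_trans (le_of_eq ?_) h
  rw [toEuclideanLin, toLpLin_eq_toLin]
  exact (rank_eq_finrank_range_toLin A _ _).symm

theorem norm_toEuclideanLin_le_sigmaMax (A : Matrix (Fin p) (Fin q) ℝ)
    (x : EuclideanSpace ℝ (Fin q)) : ‖A.toEuclideanLin x‖ ≤ sigmaMax A * ‖x‖ :=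
  LinearMap.norm_apply_le_singularValues_zero _ x

theorem sv_add_le (A B : Matrix (Fin p) (Fin q) ℝ) (k : ℕ) {c : ℝ} (hc : 0 ≤ c)
    (hB : ∀ x, ‖B.toEuclideanLin x‖ ≤ c * ‖x‖) : sv (A + B) k ≤ sv A k + c := by
  rw [sv, map_add]
  exact LinearMap.singularValues_add_le _ _ hc hB

theorem sv_mul_le_left (A : Matrix (Fin p) (Fin q) ℝ) (B : Matrix (Fin q) (Fin l) ℝ) (k : ℕ)
    {c : ℝ} (hc : 0 ≤ c) (hA : ∀ x, ‖A.toEuclideanLin x‖ ≤ c * ‖x‖) :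
    sv (A * B) k ≤ c * sv B k := by
  rw [sv, toEuclideanLin_mul]
  exact LinearMap.singularValues_comp_le_mul _ _ hc hA

theorem sv_mul_le_right (A : Matrix (Fin p) (Fin q) ℝ) (B : Matrix (Fin q) (Fin l) ℝ) (k : ℕ)
    {c : ℝ} (hc : 0 ≤ c) (hB : ∀ x, ‖B.toEuclideanLin x‖ ≤ c * ‖x‖) :
    sv (A * B) k ≤ c * sv A k := by
  rw [sv, toEuclideanLin_mul]
  exact LinearMap.singularValues_comp_le_mul' _ _ hc hB

theorem frobenius_sq_eq_sum (A : Matrix (Fin p) (Fin q) ℝ) : ‖A‖ ^ 2 = ∑ i, ∑ j, A i j ^ 2 := by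
  rw [frobenius_norm_def, ← Real.sqrt_eq_rpow, Real.sq_sqrt (by positivity)]
  simp

theorem frobenius_sq_eq_trace (A : Matrix (Fin p) (Fin q) ℝ) : ‖A‖ ^ 2 = (A * Aᵀ).trace := by
  rw [frobenius_sq_eq_sum, trace]
  simp [mul_apply, sq]

/-- Both sides are the trace of `Aᵀ A`. -/
theorem frobenius_sq_eq_sum_sv (A : Matrix (Fin p) (Fin q) ℝ) :
    ‖A‖ ^ 2 = ∑ i ∈ Finset.range q, sv A i ^ 2 := by
  have hq : finrank ℝ (EuclideanSpace ℝ (Fin q)) = q := by simp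
  have h1 : ∑ i ∈ Finset.range q, sv A i ^ 2 =
      LinearMap.trace ℝ _ (LinearMap.adjoint A.toEuclideanLin ∘ₗ A.toEuclideanLin) := by
    have := A.toEuclideanLin.isSymmetric_adjoint_comp_self.trace_eq_sum_eigenvalues hq
    rw [this, Finset.sum_range]
    exact Finset.sum_congr rfl fun i _ => LinearMap.sq_singularValues_fin _ hq i
  rw [h1, ← toEuclideanLin_conjTranspose_eq_adjoint, ← toEuclideanLin_mul,
    toEuclideanLin, toLpLin_eq_toLin, trace_toLin_eq, frobenius_sq_eq_trace, trace_mul_comm]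
  simp

theorem frobenius_sq_eq_sum_sv_of_le (A : Matrix (Fin p) (Fin q) ℝ) {N : ℕ} (hN : A.rank ≤ N) :
    ‖A‖ ^ 2 = ∑ i ∈ Finset.range N, sv A i ^ 2 := by
  have key : ∀ K, A.rank ≤ K → ∑ i ∈ Finset.range K, sv A i ^ 2 =
      ∑ i ∈ Finset.range A.rank, sv A i ^ 2 := by
    intro K hK
    refine (Finset.sum_subset (Finset.range_mono hK) fun i _ hi => ?_).symm
    rw [sv_eq_zero_of_rank_le A (by simpa using hi)]
    simp
  rw [frobenius_sq_eq_sum_sv, key q (by simpa using A.rank_le_width), key N hN]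

theorem frobenius_le_of_sv_le (A : Matrix (Fin p) (Fin q) ℝ) {p' q' : ℕ}
    (B : Matrix (Fin p') (Fin q') ℝ) {c : ℝ} (hc : 0 ≤ c) (h : ∀ k, sv A k ≤ c * sv B k) :
    ‖A‖ ≤ c * ‖B‖ := by
  refine le_of_sq_le_sq ?_ (mul_nonneg hc (norm_nonneg B))
  rw [mul_pow, frobenius_sq_eq_sum_sv_of_le A (le_max_left _ B.rank),
    frobenius_sq_eq_sum_sv_of_le B (le_max_right A.rank _), Finset.mul_sum]
  refine Finset.sum_le_sum fun i _ => ?_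
  rw [← mul_pow]
  have := sv_nonneg A i
  gcongr
  exact h i

theorem frobenius_mul_le_left (A : Matrix (Fin p) (Fin q) ℝ) (B : Matrix (Fin q) (Fin l) ℝ)
    {c : ℝ} (hc : 0 ≤ c) (hA : ∀ x, ‖A.toEuclideanLin x‖ ≤ c * ‖x‖) : ‖A * B‖ ≤ c * ‖B‖ :=
  frobenius_le_of_sv_le _ _ hc fun k => sv_mul_le_left A B k hc hA

theorem frobenius_mul_le_right (A : Matrix (Fin p) (Fin q) ℝ) (B : Matrix (Fin q) (Fin l) ℝ)
    {c : ℝ} (hc : 0 ≤ c) (hB : ∀ x, ‖B.toEuclideanLin x‖ ≤ c * ‖x‖) : ‖A * B‖ ≤ c * ‖A‖ :=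
  frobenius_le_of_sv_le _ _ hc fun k => sv_mul_le_right A B k hc hB

theorem norm_toEuclideanLin_le_frobenius (A : Matrix (Fin p) (Fin q) ℝ)
    (x : EuclideanSpace ℝ (Fin q)) : ‖A.toEuclideanLin x‖ ≤ ‖A‖ * ‖x‖ := by
  refine (norm_toEuclideanLin_le_sigmaMax A x).trans
    (mul_le_mul_of_nonneg_right ?_ (norm_nonneg x))
  refine le_of_sq_le_sq ?_ (norm_nonneg A)
  rw [frobenius_sq_eq_sum_sv_of_le A (Nat.le_succ _)]
  exact Finset.single_le_sum (f := fun i => sv A i ^ 2) (fun i _ => sq_nonneg _) (by simp)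

theorem frobenius_sq_le_of_rank_le (A : Matrix (Fin p) (Fin q) ℝ) {R : ℕ} {c : ℝ} (hc : 0 ≤ c)
    (hR : A.rank ≤ R) (hA : ∀ x, ‖A.toEuclideanLin x‖ ≤ c * ‖x‖) : ‖A‖ ^ 2 ≤ R * c ^ 2 := by
  rw [frobenius_sq_eq_sum_sv_of_le A hR]
  calc ∑ i ∈ Finset.range R, sv A i ^ 2 ≤ ∑ _i ∈ Finset.range R, c ^ 2 := by
        refine Finset.sum_le_sum fun i _ => ?_
        have := sv_nonneg A i
        gcongr
        exact LinearMap.singularValues_le_of_norm_le _ hc hA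
    _ = R * c ^ 2 := by simp

end SeqLowRank

/-! ### Best rank-one approximation, and a counting inequality for sequences. -/

namespace SeqLowRank

open Module Matrix

variable {p q l : ℕ}

theorem euclidean_norm_sq (x : EuclideanSpace ℝ (Fin p)) : ‖x‖ ^ 2 = x.ofLp ⬝ᵥ x.ofLp := by
  rw [EuclideanSpace.real_norm_sq_eq, dotProduct]
  exact Finset.sum_congr rfl fun i _ => sq _

theorem dotProduct_self_nonneg (x : Fin p → ℝ) : 0 ≤ x ⬝ᵥ x :=
  Finset.sum_nonneg fun i _ => mul_self_nonneg (x i)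

theorem euclidean_inner (x y : EuclideanSpace ℝ (Fin p)) : inner ℝ x y = x.ofLp ⬝ᵥ y.ofLp := by
  rw [EuclideanSpace.inner_eq_star_dotProduct, dotProduct_comm]
  simp

theorem vecMulVec_zero_right (b : Fin p → ℝ) : vecMulVec b (0 : Fin q → ℝ) = 0 := by
  ext i j
  simp [vecMulVec_apply]

theorem frobenius_sq_sub_vecMulVec (A : Matrix (Fin p) (Fin q) ℝ) (b : Fin p → ℝ)
    (w : Fin q → ℝ) :
    ‖A - vecMulVec b w‖ ^ 2 = ‖A‖ ^ 2 - 2 * (b ⬝ᵥ A *ᵥ w) + (b ⬝ᵥ b) * (w ⬝ᵥ w) := by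
  simp only [frobenius_sq_eq_sum, Matrix.sub_apply, vecMulVec_apply, dotProduct, mulVec]
  rw [Finset.sum_mul, Finset.mul_sum, ← Finset.sum_sub_distrib, ← Finset.sum_add_distrib]
  refine Finset.sum_congr rfl fun i _ => ?_
  rw [Finset.mul_sum, Finset.mul_sum, Finset.mul_sum, ← Finset.sum_sub_distrib,
    ← Finset.sum_add_distrib]
  refine Finset.sum_congr rfl fun j _ => ?_
  ring

/-- `(b, w)` is a best rank-one approximation `b wᵀ` of `A` in the Frobenius norm. -/
def IsBestRankOne (A : Matrix (Fin p) (Fin q) ℝ) (b : Fin p → ℝ) (w : Fin q → ℝ) : Prop :=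
  ∀ b' w', ‖A - vecMulVec b w‖ ≤ ‖A - vecMulVec b' w'‖

namespace IsBestRankOne

variable {A : Matrix (Fin p) (Fin q) ℝ} {b : Fin p → ℝ} {w : Fin q → ℝ}

theorem transpose (h : IsBestRankOne A b w) : IsBestRankOne Aᵀ w b := by
  intro w' b'
  have := h b' w'
  rwa [← frobenius_norm_transpose, ← frobenius_norm_transpose (A - vecMulVec b' w'),
    transpose_sub, transpose_sub, transpose_vecMulVec, transpose_vecMulVec] at this

theorem expand_le (h : IsBestRankOne A b w) (b' : Fin p → ℝ) (w' : Fin q → ℝ) :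
    -2 * (b ⬝ᵥ A *ᵥ w) + (b ⬝ᵥ b) * (w ⬝ᵥ w) ≤
      -2 * (b' ⬝ᵥ A *ᵥ w') + (b' ⬝ᵥ b') * (w' ⬝ᵥ w') := by
  have h1 : ‖A - vecMulVec b w‖ ^ 2 ≤ ‖A - vecMulVec b' w'‖ ^ 2 := by
    have := h b' w'
    gcongr
  rw [frobenius_sq_sub_vecMulVec, frobenius_sq_sub_vecMulVec] at h1
  linarith

/-- First-order optimality in `b`: moving `b` along the residual `z` would lower the error unless `z
= 0`. -/
theorem mulVec_eq (h : IsBestRankOne A b w) : A *ᵥ w = (w ⬝ᵥ w) • b := by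
  set ω := w ⬝ᵥ w
  have hω : 0 ≤ ω := dotProduct_self_nonneg w
  set z := A *ᵥ w - ω • b with hz
  have hzz : 0 ≤ z ⬝ᵥ z := dotProduct_self_nonneg z
  have hAw : A *ᵥ w = z + ω • b := by rw [hz]; abel
  set t : ℝ := 1 / (1 + ω)
  have ht : 0 < t := by positivity
  have htω : t * ω ≤ 1 := by
    rw [div_mul_eq_mul_div, div_le_one (by positivity)]; linarith
  have h1 := h.expand_le (b + t • z) w
  rw [hAw] at h1
  simp only [add_dotProduct, dotProduct_add, smul_dotProduct, dotProduct_smul, smul_eq_mul] at h1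
  rw [dotProduct_comm b z] at h1
  have h2 : 0 ≤ t * (z ⬝ᵥ z) * (t * ω - 2) := by
    linear_combination h1
  have h3 : z ⬝ᵥ z = 0 := by
    by_contra hne
    have : 0 < t * (z ⬝ᵥ z) := mul_pos ht (hzz.lt_of_ne' hne)
    nlinarith
  rw [hAw, dotProduct_self_eq_zero.1 h3, zero_add]

theorem vecMul_eq (h : IsBestRankOne A b w) : b ᵥ* A = (b ⬝ᵥ b) • w := by
  rw [← mulVec_transpose]
  exact h.transpose.mulVec_eq

/-- Comparison with the optimal left factor `A x / |x|²` for the right factor `x`: the removed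
component attains the operator norm of `A`. -/
theorem mulVec_sq_le (h : IsBestRankOne A b w) (x : Fin q → ℝ) :
    (A *ᵥ x) ⬝ᵥ (A *ᵥ x) ≤ (b ⬝ᵥ b) * (w ⬝ᵥ w) * (x ⬝ᵥ x) := by
  rcases (dotProduct_self_nonneg x : 0 ≤ x ⬝ᵥ x).eq_or_lt with h0 | h0
  · rw [dotProduct_self_eq_zero.1 h0.symm]; simp
  have h1 := h.expand_le ((x ⬝ᵥ x)⁻¹ • (A *ᵥ x)) x
  rw [h.mulVec_eq] at h1
  simp only [smul_dotProduct, dotProduct_smul, smul_eq_mul] at h1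
  rw [← div_le_iff₀ h0]
  have h2 : (x ⬝ᵥ x)⁻¹ * ((x ⬝ᵥ x)⁻¹ * (A *ᵥ x ⬝ᵥ A *ᵥ x)) * (x ⬝ᵥ x) =
      (A *ᵥ x ⬝ᵥ A *ᵥ x) / (x ⬝ᵥ x) := by field_simp
  rw [h2, inv_mul_eq_div] at h1
  linarith

theorem eq_zero_of_eq_zero (h : IsBestRankOne A b w) (hw : w = 0) : A = 0 := by
  ext i j
  have h1 := h.mulVec_sq_le (Pi.single j 1)
  rw [hw, dotProduct_zero, mul_zero, zero_mul] at h1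
  have := dotProduct_self_eq_zero.1 (le_antisymm h1 (dotProduct_self_nonneg _))
  simpa using congrFun this i

end IsBestRankOne

theorem norm_one_sub_vecMulVec_le (w : Fin q → ℝ) (x : EuclideanSpace ℝ (Fin q)) :
    ‖(1 - vecMulVec ((w ⬝ᵥ w)⁻¹ • w) w).toEuclideanLin x‖ ≤ 1 * ‖x‖ := by
  refine le_of_sq_le_sq ?_ (by positivity)
  rw [one_mul, euclidean_norm_sq, euclidean_norm_sq]
  set y := x.ofLp
  have h1 : ((1 - vecMulVec ((w ⬝ᵥ w)⁻¹ • w) w).toEuclideanLin x).ofLp =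
      y - ((w ⬝ᵥ y) * (w ⬝ᵥ w)⁻¹) • w := by
    ext i
    simp [toLpLin_apply, vecMulVec_mulVec, y]
    ring
  rw [h1]
  simp only [sub_dotProduct, dotProduct_sub, smul_dotProduct, dotProduct_smul, smul_eq_mul]
  rw [dotProduct_comm y w]
  rcases (dotProduct_self_nonneg w : 0 ≤ w ⬝ᵥ w).eq_or_lt with h0 | h0
  · rw [← h0]; simp
  · have : 0 ≤ (w ⬝ᵥ y) ^ 2 * (w ⬝ᵥ w)⁻¹ := by positivity
    have h2 : (w ⬝ᵥ w)⁻¹ * (w ⬝ᵥ w) = 1 := inv_mul_cancel₀ h0.ne'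
    linear_combination this + (w ⬝ᵥ y) ^ 2 * (w ⬝ᵥ w)⁻¹ * h2

theorem IsBestRankOne.sv_sub_le {A : Matrix (Fin p) (Fin q) ℝ} {b : Fin p → ℝ} {w : Fin q → ℝ}
    (h : IsBestRankOne A b w) (hw : w ≠ 0) (k : ℕ) : sv (A - vecMulVec b w) k ≤ sv A (k + 1) := by
  have hw0 : 0 < w ⬝ᵥ w :=
    (dotProduct_self_nonneg w).lt_of_ne' fun h => hw (dotProduct_self_eq_zero.1 h)
  set s := √(w ⬝ᵥ w)
  have hs : 0 < s := Real.sqrt_pos.2 hw0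
  have hss : s ^ 2 = w ⬝ᵥ w := Real.sq_sqrt hw0.le
  refine LinearMap.singularValues_deflation_le _ _ (v := WithLp.toLp 2 (s⁻¹ • w))
    (b := WithLp.toLp 2 (s • b)) ?_ ?_ ?_ ?_ ?_ k
  · have : ‖(WithLp.toLp 2 (s⁻¹ • w) : EuclideanSpace ℝ (Fin q))‖ ^ 2 = 1 := by
      rw [euclidean_norm_sq]
      simp only [smul_dotProduct, dotProduct_smul, smul_eq_mul]
      rw [← hss]
      field_simp
    exact (pow_eq_one_iff_of_nonneg (norm_nonneg _) two_ne_zero).1 this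
  · intro x
    rw [euclidean_inner]
    ext i
    simp [toLpLin_apply, vecMulVec_mulVec]
    field_simp
    ring
  · ext i
    simp [toLpLin_apply, vecMulVec_mulVec, h.mulVec_eq]
  · intro x
    rw [euclidean_inner]
    have : b ᵥ* (A - vecMulVec b w) = 0 := by
      rw [vecMul_sub, h.vecMul_eq, vecMul_vecMulVec, sub_self]
    simp only [toLpLin_apply]
    rw [dotProduct_comm, smul_dotProduct, dotProduct_mulVec, this, zero_dotProduct, smul_zero]
  · intro x
    refine le_of_sq_le_sq ?_ (by positivity)
    rw [mul_pow, euclidean_norm_sq, euclidean_norm_sq, euclidean_norm_sq]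
    have := h.mulVec_sq_le x.ofLp
    simp only [toLpLin_apply, smul_dotProduct, dotProduct_smul, smul_eq_mul]
    rw [← hss] at this
    linear_combination this

/-- Subtracting a best rank-one approximation is a two-sided compression by contractions which
differ from the identity by matrices of rank at most one, and it shifts the singular values. -/
theorem IsBestRankOne.exists_compression {A : Matrix (Fin p) (Fin q) ℝ} {b : Fin p → ℝ}
    {w : Fin q → ℝ} (h : IsBestRankOne A b w) :
    ∃ (Q : Matrix (Fin p) (Fin p) ℝ) (Q' : Matrix (Fin q) (Fin q) ℝ),
      (∀ x, ‖Q.toEuclideanLin x‖ ≤ 1 * ‖x‖) ∧ (∀ x, ‖Q'.toEuclideanLin x‖ ≤ 1 * ‖x‖) ∧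
      (1 - Q).rank ≤ 1 ∧ (1 - Q').rank ≤ 1 ∧ A - vecMulVec b w = Q * A * Q' ∧
      ∀ k, sv (A - vecMulVec b w) k ≤ sv A (k + 1) := by
  -- Projections onto the complements of `b` and `w`; since `0⁻¹ = 0`, each is the identity when its
  -- vector vanishes.
  refine ⟨1 - vecMulVec ((b ⬝ᵥ b)⁻¹ • b) b, 1 - vecMulVec ((w ⬝ᵥ w)⁻¹ • w) w,
    norm_one_sub_vecMulVec_le b, norm_one_sub_vecMulVec_le w, ?_, ?_, ?_, ?_⟩
  · rw [sub_sub_cancel]; exact rank_vecMulVec_le _ _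
  · rw [sub_sub_cancel]; exact rank_vecMulVec_le _ _
  · by_cases hw : w = 0
    · have hA := h.eq_zero_of_eq_zero hw
      simp [hw, hA, vecMulVec_zero_right]
    have hw0 : w ⬝ᵥ w ≠ 0 := fun h => hw (dotProduct_self_eq_zero.1 h)
    have h1 : A * (1 - vecMulVec ((w ⬝ᵥ w)⁻¹ • w) w) = A - vecMulVec b w := by
      rw [Matrix.mul_sub, Matrix.mul_one, mul_vecMulVec, mulVec_smul, h.mulVec_eq, smul_smul,
        inv_mul_cancel₀ hw0, one_smul]
    have h2 : b ᵥ* (A - vecMulVec b w) = 0 := by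
      rw [vecMul_sub, h.vecMul_eq, vecMul_vecMulVec, sub_self]
    rw [Matrix.mul_assoc, h1, Matrix.sub_mul, Matrix.one_mul, vecMulVec_mul, h2,
      vecMulVec_zero_right, sub_zero]
  · intro k
    by_cases hw : w = 0
    · have hA := h.eq_zero_of_eq_zero hw
      rw [hw, vecMulVec_zero_right, sub_zero, sv_eq_zero_of_rank_le A (by simp [hA])]
      exact sv_nonneg _ _
    · exact h.sv_sub_le hw k

/-- If `x (i + j) ≤ τ i + H j` for all `j ≤ r` and `H` vanishes at `r`, then the `ℓ²` norm of `x`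
exceeds the `ℓ¹` norm of `τ` only by a multiple of the `ℓ¹` norm of `H`. -/
theorem exists_sum_sq_le_of_le_add (x τ H : ℕ → ℝ) (r : ℕ) (hx : ∀ i, 0 ≤ x i)
    (hτ : ∀ i, 0 ≤ τ i) (hH : ∀ j, 0 ≤ H j) (hH0 : ∀ j, H j ≤ H 0) (hr : H r = 0)
    (h : ∀ i, ∀ j ≤ r, x (i + j) ≤ τ i + H j) (N : ℕ) :
    ∃ a b, a + b = N ∧ b ≤ r ∧ ∑ t ∈ Finset.range N, x t ^ 2 ≤
      ∑ i ∈ Finset.range a, (τ i ^ 2 + 3 * H 0 * τ i) +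
        ∑ j ∈ Finset.range b, 4 * H j ^ 2 := by
  induction N with
  | zero => exact ⟨0, 0, by simp⟩
  | succ N ih =>
    obtain ⟨a, b, rfl, hb, hsum⟩ := ih
    have h1 := h a b hb
    have h2 : x (a + b) ^ 2 ≤ (τ a + H b) ^ 2 := by
      have := hx (a + b)
      gcongr
    -- Greedy charging: the term `x (a + b)` is paid by the larger of `τ a` and `H b`, and only that
    -- index advances. As `H r = 0`, at most `r` terms are charged to `H`.
    by_cases hc : H b ≤ τ a
    · refine ⟨a + 1, b, by omega, hb, ?_⟩
      rw [Finset.sum_range_succ, Finset.sum_range_succ _ a]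
      have h3 : H b * H b ≤ H 0 * τ a := mul_le_mul (hH0 b) hc (hH b) (hH 0)
      have h4 : H b * τ a ≤ H 0 * τ a := mul_le_mul_of_nonneg_right (hH0 b) (hτ a)
      nlinarith
    · have hbr : b ≠ r := fun hh => hc (by rw [hh, hr]; exact hτ a)
      refine ⟨a, b + 1, by omega, by omega, ?_⟩
      rw [Finset.sum_range_succ, Finset.sum_range_succ _ b]
      have h3 : (τ a + H b) ^ 2 ≤ (2 * H b) ^ 2 := by
        have := hτ a
        have := hH b
        gcongr
        linarith [not_le.1 hc]
      nlinarith

theorem sum_sq_le_of_le_add (x τ H : ℕ → ℝ) (r : ℕ) (hx : ∀ i, 0 ≤ x i)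
    (hτ : ∀ i, 0 ≤ τ i) (hH : ∀ j, 0 ≤ H j) (hH0 : ∀ j, H j ≤ H 0) (hr : H r = 0)
    (h : ∀ i, ∀ j ≤ r, x (i + j) ≤ τ i + H j) (N : ℕ) :
    ∑ t ∈ Finset.range N, x t ^ 2 ≤
      (∑ i ∈ Finset.range N, τ i + 3 / 2 * H 0 + 2 * ∑ j ∈ Finset.range r, H j) ^ 2 := by
  obtain ⟨a, b, hab, hb, hsum⟩ := exists_sum_sq_le_of_le_add x τ H r hx hτ hH hH0 hr h N
  have h1 : ∑ i ∈ Finset.range a, τ i ≤ ∑ i ∈ Finset.range N, τ i :=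
    Finset.sum_le_sum_of_subset_of_nonneg (Finset.range_mono (by omega)) fun i _ _ => hτ i
  have h2 : ∑ i ∈ Finset.range b, H i ≤ ∑ i ∈ Finset.range r, H i :=
    Finset.sum_le_sum_of_subset_of_nonneg (Finset.range_mono hb) fun i _ _ => hH i
  have h3 := Finset.sum_sq_le_sq_sum_of_nonneg (s := Finset.range a) (f := τ) fun i _ => hτ i
  have h4 := Finset.sum_sq_le_sq_sum_of_nonneg (s := Finset.range b) (f := H) fun i _ => hH i
  have h5 : 0 ≤ ∑ i ∈ Finset.range a, τ i := Finset.sum_nonneg fun i _ => hτ i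
  have h6 : 0 ≤ ∑ i ∈ Finset.range b, H i := Finset.sum_nonneg fun i _ => hH i
  have h7 := hH 0
  calc _ ≤ _ := hsum
    _ ≤ (∑ i ∈ Finset.range a, τ i + 3 / 2 * H 0 + 2 * ∑ j ∈ Finset.range b, H j) ^ 2 := by
      rw [Finset.sum_add_distrib, ← Finset.mul_sum, ← Finset.mul_sum]
      nlinarith [mul_nonneg h5 h6, mul_nonneg h7 h6, mul_nonneg h7 h5]
    _ ≤ _ := by gcongr

end SeqLowRank

/-! ### Compressing signal and noise separately along an inexact deflation. -/

namespace SeqLowRank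

open Module Matrix

variable {p q : ℕ}

theorem matrix_rank_add_le (A B : Matrix (Fin p) (Fin q) ℝ) :
    (A + B).rank ≤ A.rank + B.rank := by
  rw [rank, mulVecLin_add]
  exact (Submodule.finrank_mono (LinearMap.range_add_le _ _)).trans
    (Submodule.finrank_add_le_finrank_add_finrank _ _)

/-- Two-sided compression of `Z` by the first `k` matrices of two sequences. -/
def compress (Q : ℕ → Matrix (Fin p) (Fin p) ℝ) (Q' : ℕ → Matrix (Fin q) (Fin q) ℝ)
    (Z : Matrix (Fin p) (Fin q) ℝ) : ℕ → Matrix (Fin p) (Fin q) ℝ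
  | 0 => Z
  | k + 1 => Q k * compress Q Q' Z k * Q' k

section compress

variable {Q : ℕ → Matrix (Fin p) (Fin p) ℝ} {Q' : ℕ → Matrix (Fin q) (Fin q) ℝ} {r : ℕ}

theorem norm_mul_mul_apply_le {A : Matrix (Fin p) (Fin p) ℝ} {B : Matrix (Fin q) (Fin q) ℝ}
    (hA : ∀ x, ‖A.toEuclideanLin x‖ ≤ 1 * ‖x‖) (hB : ∀ x, ‖B.toEuclideanLin x‖ ≤ 1 * ‖x‖)
    {Z : Matrix (Fin p) (Fin q) ℝ} {η : ℝ} (hη : 0 ≤ η)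
    (hZ : ∀ x, ‖Z.toEuclideanLin x‖ ≤ η * ‖x‖) (x : EuclideanSpace ℝ (Fin q)) :
    ‖(A * Z * B).toEuclideanLin x‖ ≤ η * ‖x‖ := by
  rw [toEuclideanLin_mul, toEuclideanLin_mul]
  simp only [LinearMap.comp_apply]
  refine (hA _).trans ((one_mul _).trans_le ((hZ _).trans ?_))
  have := hB x
  rw [one_mul] at this
  gcongr

theorem sv_mul_mul_le {A : Matrix (Fin p) (Fin p) ℝ} {B : Matrix (Fin q) (Fin q) ℝ}
    (hA : ∀ x, ‖A.toEuclideanLin x‖ ≤ 1 * ‖x‖) (hB : ∀ x, ‖B.toEuclideanLin x‖ ≤ 1 * ‖x‖)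
    (Z : Matrix (Fin p) (Fin q) ℝ) (k : ℕ) : sv (A * Z * B) k ≤ sv Z k := by
  have h1 := sv_mul_le_right (A * Z) B k zero_le_one hB
  have h2 := sv_mul_le_left A Z k zero_le_one hA
  linarith

theorem frobenius_mul_mul_le {A : Matrix (Fin p) (Fin p) ℝ} {B : Matrix (Fin q) (Fin q) ℝ}
    (hA : ∀ x, ‖A.toEuclideanLin x‖ ≤ 1 * ‖x‖) (hB : ∀ x, ‖B.toEuclideanLin x‖ ≤ 1 * ‖x‖)
    (Z : Matrix (Fin p) (Fin q) ℝ) : ‖A * Z * B‖ ≤ ‖Z‖ := by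
  have h1 := frobenius_mul_le_right (A * Z) B zero_le_one hB
  have h2 := frobenius_mul_le_left A Z zero_le_one hA
  linarith

theorem norm_compress_apply_le (hQ : ∀ k < r, ∀ x, ‖(Q k).toEuclideanLin x‖ ≤ 1 * ‖x‖)
    (hQ' : ∀ k < r, ∀ x, ‖(Q' k).toEuclideanLin x‖ ≤ 1 * ‖x‖)
    {Z : Matrix (Fin p) (Fin q) ℝ} {η : ℝ} (hη : 0 ≤ η)
    (hZ : ∀ x, ‖Z.toEuclideanLin x‖ ≤ η * ‖x‖) :
    ∀ k ≤ r, ∀ x, ‖(compress Q Q' Z k).toEuclideanLin x‖ ≤ η * ‖x‖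
  | 0, _ => hZ
  | k + 1, hk => norm_mul_mul_apply_le (hQ k hk) (hQ' k hk) hη
      (norm_compress_apply_le hQ hQ' hη hZ k (by omega))

theorem sv_compress_le (hQ : ∀ k < r, ∀ x, ‖(Q k).toEuclideanLin x‖ ≤ 1 * ‖x‖)
    (hQ' : ∀ k < r, ∀ x, ‖(Q' k).toEuclideanLin x‖ ≤ 1 * ‖x‖)
    (Z : Matrix (Fin p) (Fin q) ℝ) (i k : ℕ) :
    ∀ j, k + j ≤ r → sv (compress Q Q' Z (k + j)) i ≤ sv (compress Q Q' Z k) i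
  | 0, _ => le_rfl
  | j + 1, hj => (sv_mul_mul_le (hQ (k + j) (by omega)) (hQ' (k + j) (by omega)) _ i).trans
      (sv_compress_le hQ hQ' Z i k j (by omega))

/-- Each step changes the matrix by rank at most two, one from either side. -/
theorem rank_sub_compress_le (hQ : ∀ k < r, (1 - Q k).rank ≤ 1)
    (hQ' : ∀ k < r, (1 - Q' k).rank ≤ 1) (Z : Matrix (Fin p) (Fin q) ℝ) :
    ∀ k ≤ r, (Z - compress Q Q' Z k).rank ≤ 2 * k
  | 0, _ => by simp [compress]
  | k + 1, hk => by
    set W := compress Q Q' Z k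
    have h : Z - compress Q Q' Z (k + 1) =
        (Z - W) + ((1 - Q k) * W + Q k * W * (1 - Q' k)) := by
      rw [compress, Matrix.sub_mul, Matrix.one_mul, Matrix.mul_sub, Matrix.mul_one]
      abel
    rw [h]
    have h1 : (Z - W).rank ≤ 2 * k := rank_sub_compress_le hQ hQ' Z k (by omega)
    have h2 := matrix_rank_add_le (Z - W) ((1 - Q k) * W + Q k * W * (1 - Q' k))
    have h3 := matrix_rank_add_le ((1 - Q k) * W) (Q k * W * (1 - Q' k))
    have h4 := (rank_mul_le_left (1 - Q k) W).trans (hQ k hk)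
    have h5 := (rank_mul_le_right (Q k * W) (1 - Q' k)).trans (hQ' k hk)
    omega

end compress

/-- Error of inexact deflation of a noisy matrix `M + E`: each of the matrices `A k` is compressed
along its leading singular vectors and then perturbed by `Δ k`. -/
theorem frobenius_inexact_deflation_le {M E : Matrix (Fin p) (Fin q) ℝ}
    {A Δ : ℕ → Matrix (Fin p) (Fin q) ℝ} {Q : ℕ → Matrix (Fin p) (Fin p) ℝ}
    {Q' : ℕ → Matrix (Fin q) (Fin q) ℝ} {η : ℝ} {r : ℕ} (hr : 1 ≤ r) (hη : 0 ≤ η)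
    (hE : ∀ x, ‖E.toEuclideanLin x‖ ≤ η * ‖x‖) (hA0 : A 0 = M + E)
    (hQ : ∀ k < r, ∀ x, ‖(Q k).toEuclideanLin x‖ ≤ 1 * ‖x‖)
    (hQ' : ∀ k < r, ∀ x, ‖(Q' k).toEuclideanLin x‖ ≤ 1 * ‖x‖)
    (hQr : ∀ k < r, (1 - Q k).rank ≤ 1) (hQr' : ∀ k < r, (1 - Q' k).rank ≤ 1)
    (hA : ∀ k < r, A (k + 1) = Q k * A k * Q' k - Δ k)
    (hsv : ∀ k < r, ∀ i, sv (Q k * A k * Q' k) i ≤ sv (A k) (i + 1)) :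
    ‖A r - E‖ ≤ ∑ i ∈ Finset.range q, sv M (r + i) + ∑ l ∈ Finset.range r, ‖Δ l‖ +
      7 * ∑ k ∈ Finset.range r, ∑ l ∈ Finset.range k, ‖Δ l‖ + 10 * r * η := by
  set G : ℕ → ℝ := fun k => ∑ l ∈ Finset.range k, ‖Δ l‖ with hG
  have hG0 : ∀ k, 0 ≤ G k := fun k => Finset.sum_nonneg fun _ _ => norm_nonneg _
  have hGs : ∀ k, G (k + 1) = G k + ‖Δ k‖ := fun k => Finset.sum_range_succ _ _
  have hGmono : Monotone G := monotone_nat_of_le_succ fun k => by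
    rw [hGs]; linarith [norm_nonneg (Δ k)]
  set N := compress Q Q' M
  set F := compress Q Q' E
  have hNs : ∀ k, N (k + 1) = Q k * N k * Q' k := fun _ => rfl
  have hFs : ∀ k, F (k + 1) = Q k * F k * Q' k := fun _ => rfl
  have hF := norm_compress_apply_le hQ hQ' hη hE
  have hΓ : ∀ k ≤ r, ‖N k + F k - A k‖ ≤ G k := by
    intro k
    induction k with
    | zero => intro _; simp [hA0, N, F, compress, G]
    | succ k ih =>
      intro hk
      have h1 : N (k + 1) + F (k + 1) - A (k + 1) =
          Q k * (N k + F k - A k) * Q' k + Δ k := by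
        rw [hA k hk, hNs, hFs]
        simp only [Matrix.mul_sub, Matrix.mul_add, Matrix.sub_mul, Matrix.add_mul]
        abel
      rw [h1, hGs]
      refine (norm_add_le _ _).trans (add_le_add ?_ le_rfl)
      exact (frobenius_mul_mul_le (hQ k hk) (hQ' k hk) _).trans (ih (by omega))
  have hsvA : ∀ k ≤ r, ∀ i, sv (A k) i ≤ sv M (i + k) + η + G k := by
    intro k
    induction k with
    | zero =>
      intro _ i
      rw [hA0]
      have := sv_add_le M E i hη hE
      simpa [G] using this
    | succ k ih =>
      intro hk i
      have h1 := sv_add_le (Q k * A k * Q' k) (-Δ k) i (norm_nonneg (-Δ k))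
        (norm_toEuclideanLin_le_frobenius _)
      rw [← sub_eq_add_neg, ← hA k hk, norm_neg] at h1
      have h2 := hsv k hk i
      have h3 := ih (by omega) (i + 1)
      rw [hGs, show i + (k + 1) = i + 1 + k by ring]
      linarith
  -- `N` is compared with `A`, whose singular values shift: going from `N` to `A` and from `A` back
  -- to `M` each costs `η + G k`.
  have hsvN : ∀ k < r, ∀ i, sv (N (k + 1)) i ≤ sv M (i + (k + 1)) + (2 * η + 2 * G k) := by
    intro k hk i
    have h1 : N (k + 1) = Q k * A k * Q' k + Q k * (N k + F k - A k) * Q' k + -F (k + 1) := by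
      rw [hNs, hFs]
      simp only [Matrix.mul_sub, Matrix.mul_add, Matrix.sub_mul, Matrix.add_mul]
      abel
    have h2 := sv_add_le (Q k * A k * Q' k + Q k * (N k + F k - A k) * Q' k) (-F (k + 1)) i hη
      (fun x => by simpa using hF (k + 1) hk x)
    have h3 := sv_add_le (Q k * A k * Q' k) (Q k * (N k + F k - A k) * Q' k) i (hG0 k) (fun x =>
      (norm_toEuclideanLin_le_frobenius _ x).trans (mul_le_mul_of_nonneg_right
        ((frobenius_mul_mul_le (hQ k hk) (hQ' k hk) _).trans (hΓ k hk.le)) (norm_nonneg x)))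
    rw [← h1] at h2
    have h4 := hsv k hk i
    have h5 := hsvA k hk.le (i + 1)
    rw [show i + 1 + k = i + (k + 1) by ring] at h5
    linarith
  -- Stopping `j` compressions early reaches the same tail index `r + i` from index `i + j`, with a
  -- smaller error. At `j = r` there is no compression and no error.
  set H : ℕ → ℝ := fun j => if j < r then 2 * η + 2 * G (r - 1 - j) else 0 with hH
  have hHlt : ∀ j < r, H j = 2 * η + 2 * G (r - 1 - j) := fun j hj => if_pos hj
  have hHnn : ∀ j, 0 ≤ H j := by
    intro j
    have := hG0 (r - 1 - j)
    simp only [hH]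
    split_ifs <;> positivity
  have hNF : ‖N r‖ ≤ ∑ i ∈ Finset.range q, sv M (r + i) + 3 / 2 * H 0 +
      2 * ∑ j ∈ Finset.range r, H j := by
    refine le_of_sq_le_sq ?_ ?_
    · rw [frobenius_sq_eq_sum_sv]
      refine sum_sq_le_of_le_add _ _ H r (sv_nonneg _) (fun i => sv_nonneg _ _) hHnn ?_ ?_ ?_ q
      · intro j
        by_cases hj : j < r
        · rw [hHlt j hj, hHlt 0 hr]
          have := hGmono (show r - 1 - j ≤ r - 1 - 0 by omega)
          linarith
        · simpa [hH, hj] using hHnn 0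
      · simp [hH]
      · intro i j hj
        rcases hj.lt_or_eq with hj | rfl
        · have h1 := sv_compress_le hQ hQ' M (i + j) (r - j) j (by omega)
          have h2 := hsvN (r - 1 - j) (by omega) (i + j)
          rw [show r - j + j = r by omega] at h1
          rw [show r - 1 - j + 1 = r - j by omega, show i + j + (r - j) = r + i by omega] at h2
          rw [hHlt j hj]
          exact h1.trans h2
        · have h1 := sv_compress_le hQ hQ' M (i + j) 0 j (by omega)
          simp only [zero_add] at h1
          simp only [hH, lt_irrefl, if_false, add_zero]
          rw [add_comm j i]
          exact h1
    · have h1 : 0 ≤ ∑ i ∈ Finset.range q, sv M (r + i) :=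
        Finset.sum_nonneg fun i _ => sv_nonneg _ _
      have h2 : 0 ≤ ∑ j ∈ Finset.range r, H j := Finset.sum_nonneg fun j _ => hHnn j
      have h3 := hHnn 0
      positivity
  have hHsum : ∑ j ∈ Finset.range r, H j = 2 * r * η + 2 * ∑ k ∈ Finset.range r, G k := by
    rw [Finset.sum_congr rfl fun j hj => hHlt j (Finset.mem_range.1 hj), Finset.sum_add_distrib,
      ← Finset.mul_sum (Finset.range r) (fun j => G (r - 1 - j)) 2, Finset.sum_range_reflect]
    simp
    ring
  have hG1 : G (r - 1) ≤ ∑ k ∈ Finset.range r, G k :=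
    Finset.single_le_sum (fun k _ => hG0 k) (Finset.mem_range.2 (by omega))
  have hr' : (1 : ℝ) ≤ r := by exact_mod_cast hr
  -- Rank at most `2r` and operator norm at most `2η` give a squared norm of at most `8 r η²`, hence
  -- at most `9 r² η²`.
  have hEF : ‖E - F r‖ ≤ 3 * r * η := by
    refine le_of_sq_le_sq ?_ (by positivity)
    have h1 := frobenius_sq_le_of_rank_le (E - F r) (c := 2 * η) (by positivity)
      (rank_sub_compress_le hQr hQr' E r le_rfl) (fun x => by
        rw [map_sub, LinearMap.sub_apply]
        have h2 := norm_sub_le (E.toEuclideanLin x) ((F r).toEuclideanLin x)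
        linarith [hE x, hF r le_rfl x])
    push_cast at h1
    nlinarith [mul_nonneg (sq_nonneg η) (by nlinarith : (0 : ℝ) ≤ 9 * r ^ 2 - 8 * r)]
  have hsplit : A r - E = N r - (N r + F r - A r) - (E - F r) := by abel
  rw [hsplit]
  have h1 := norm_sub_le (N r - (N r + F r - A r)) (E - F r)
  have h2 := norm_sub_le (N r) (N r + F r - A r)
  have h3 := hΓ r le_rfl
  have h4 : H 0 = 2 * η + 2 * G (r - 1) := by rw [hHlt 0 hr, Nat.sub_zero]
  rw [h4, hHsum] at hNF
  have h5 : η ≤ r * η := le_mul_of_one_le_left hη hr'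
  linarith

end SeqLowRank

/-! ### Reduction of the algorithm to deflation on the row space of `X`. -/

namespace SeqLowRank

open Module Matrix

variable {m d n : ℕ}

/-- A right inverse of norm at most the inverse of the smallest singular value. -/
theorem exists_right_inverse {X : Matrix (Fin d) (Fin n) ℝ} (hX : 0 < sigmaMin X) :
    ∃ J : Matrix (Fin n) (Fin d) ℝ, X * J = 1 ∧
      ∀ x, ‖J.toEuclideanLin x‖ ≤ (sigmaMin X)⁻¹ * ‖x‖ := by
  set T := X.toEuclideanLin
  have hrange : d - 1 < finrank ℝ (LinearMap.range T) :=
    T.singularValues_pos_iff_lt_finrank_range.1 hX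
  have hd : finrank ℝ (LinearMap.range T) ≤ d := by
    simpa using Submodule.finrank_le (LinearMap.range T)
  have hn : finrank ℝ (LinearMap.range T) ≤ finrank ℝ (EuclideanSpace ℝ (Fin n)) :=
    T.finrank_range_le
  obtain ⟨V, hV, hV'⟩ := T.exists_submodule_singularValues_mul_norm_le (hrange.trans_le hn)
  have hinj : Function.Injective (T.domRestrict V) := by
    rw [← LinearMap.ker_eq_bot, LinearMap.ker_eq_bot']
    rintro ⟨x, hx⟩ hh
    have h1 := hV' x hx
    rw [show T x = 0 from hh, norm_zero] at h1
    by_contra hx0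
    refine absurd h1 (not_le.2 (mul_pos hX (norm_pos_iff.2 fun h => hx0 (Subtype.ext h))))
  -- Positivity of `sigmaMin X` forces `d ≥ 1`, so the truncated `d - 1 + 1` is `d`.
  have hfin : finrank ℝ V = finrank ℝ (EuclideanSpace ℝ (Fin d)) := by
    rw [hV, finrank_euclideanSpace_fin]; omega
  let e := LinearEquiv.ofInjectiveOfFinrankEq (T.domRestrict V) hinj hfin
  have he : ∀ x, T (e.symm x : EuclideanSpace ℝ (Fin n)) = x := fun x => e.apply_symm_apply x
  refine ⟨toEuclideanLin.symm (V.subtype ∘ₗ (e.symm : EuclideanSpace ℝ (Fin d) →ₗ[ℝ] V)), ?_, ?_⟩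
  · apply toEuclideanLin.injective
    rw [toEuclideanLin_mul, LinearEquiv.apply_symm_apply]
    ext x : 1
    simp [he, T]
  · intro x
    rw [LinearEquiv.apply_symm_apply, inv_mul_eq_div, le_div_iff₀' hX]
    have := hV' _ (e.symm x).2
    rw [he] at this
    exact this

/-- The orthogonal projection onto the row space of a matrix of full row rank. -/
theorem exists_rowspace_projection {X : Matrix (Fin d) (Fin n) ℝ} (hX : 0 < sigmaMin X) :
    ∃ (P : Matrix (Fin n) (Fin n) ℝ) (S : Matrix (Fin n) (Fin d) ℝ),
      P = S * X ∧ X * P = X ∧ Pᵀ = P ∧ P * P = P ∧ ∀ x, ‖P.toEuclideanLin x‖ ≤ 1 * ‖x‖ := by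
  obtain ⟨J, hJ, -⟩ := exists_right_inverse hX
  have hunit : IsUnit (X * Xᵀ) := by
    rw [← mulVec_injective_iff_isUnit]
    refine (injective_iff_map_eq_zero (mulVecLin (X * Xᵀ))).2 fun z hz => ?_
    rw [mulVecLin_apply] at hz
    have h1 : (Xᵀ *ᵥ z) ⬝ᵥ (Xᵀ *ᵥ z) = 0 := by
      rw [dotProduct_mulVec, vecMul_transpose, mulVec_mulVec, hz, zero_dotProduct]
    have h2 := dotProduct_self_eq_zero.1 h1
    have h3 : (X * J)ᵀ *ᵥ z = 0 := by
      rw [transpose_mul, ← mulVec_mulVec, h2, mulVec_zero]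
    rwa [hJ, transpose_one, one_mulVec] at h3
  have hdet := (isUnit_iff_isUnit_det _).1 hunit
  have h1 : X * (Xᵀ * (X * Xᵀ)⁻¹ * X) = X := by
    rw [← Matrix.mul_assoc, ← Matrix.mul_assoc, mul_nonsing_inv _ hdet, Matrix.one_mul]
  have h2 : (Xᵀ * (X * Xᵀ)⁻¹ * X)ᵀ = Xᵀ * (X * Xᵀ)⁻¹ * X := by
    simp [transpose_nonsing_inv, Matrix.mul_assoc]
  have h3 : (Xᵀ * (X * Xᵀ)⁻¹ * X) * (Xᵀ * (X * Xᵀ)⁻¹ * X) = Xᵀ * (X * Xᵀ)⁻¹ * X := by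
    conv_lhs => rw [Matrix.mul_assoc, h1]
  refine ⟨Xᵀ * (X * Xᵀ)⁻¹ * X, Xᵀ * (X * Xᵀ)⁻¹, rfl, h1, h2, h3, ?_⟩
  set P := Xᵀ * (X * Xᵀ)⁻¹ * X
  intro x
  have h4 : ‖P.toEuclideanLin x‖ ^ 2 = inner ℝ x (P.toEuclideanLin x) := by
    rw [euclidean_norm_sq, euclidean_inner]
    simp only [toLpLin_apply]
    rw [dotProduct_mulVec, ← mulVec_transpose, mulVec_mulVec, h2, h3, dotProduct_comm]
  have h5 := real_inner_le_norm x (P.toEuclideanLin x)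
  rw [one_mul]
  by_contra hlt
  rw [not_le] at hlt
  nlinarith [norm_nonneg x]

theorem outer_mul (ab : (Fin d → ℝ) × (Fin m → ℝ)) (X : Matrix (Fin d) (Fin n) ℝ) :
    outer ab * X = vecMulVec ab.2 (ab.1 ᵥ* X) := vecMulVec_mul _ _ _

/-- Pythagoras: the part of `Y` off the range of `P` adds a constant that does not depend on `B`. -/
theorem frobenius_sq_sub_eq_add {Y B : Matrix (Fin m) (Fin n) ℝ} {P : Matrix (Fin n) (Fin n) ℝ}
    (hPt : Pᵀ = P) (hPP : P * P = P) (hB : B * P = B) :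
    ‖Y - B‖ ^ 2 = ‖Y * P - B‖ ^ 2 + ‖Y - Y * P‖ ^ 2 := by
  have h1 : (Y * P - B) * (Y - Y * P)ᵀ = 0 := by
    have h2 : (Y * P - B) * P = Y * P - B := by
      rw [Matrix.sub_mul, Matrix.mul_assoc, hPP, hB]
    rw [transpose_sub, transpose_mul, hPt, Matrix.mul_sub, ← Matrix.mul_assoc, h2, sub_self]
  have h1' : (Y - Y * P) * (Y * P - B)ᵀ = 0 := by
    rw [← transpose_transpose (Y - Y * P), ← transpose_mul, h1, transpose_zero]
  rw [frobenius_sq_eq_trace, frobenius_sq_eq_trace, frobenius_sq_eq_trace, ← trace_add,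
    show Y - B = (Y * P - B) + (Y - Y * P) by abel, transpose_add, Matrix.mul_add, Matrix.add_mul,
    Matrix.add_mul, h1, h1', add_zero, zero_add]

/-- An exact solution of the rank-one problem is a best rank-one approximation of the projection of
the label matrix to the row space of `X`. -/
theorem IsExactRank1.isBestRankOne {X : Matrix (Fin d) (Fin n) ℝ} {Y : Matrix (Fin m) (Fin n) ℝ}
    {ab : (Fin d → ℝ) × (Fin m → ℝ)} (h : IsExactRank1 X Y ab) {P : Matrix (Fin n) (Fin n) ℝ}
    {S : Matrix (Fin n) (Fin d) ℝ} (hS : P = S * X) (hXP : X * P = X) (hPt : Pᵀ = P)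
    (hPP : P * P = P) (hP : ∀ x, ‖P.toEuclideanLin x‖ ≤ 1 * ‖x‖) :
    IsBestRankOne (Y * P) ab.2 (ab.1 ᵥ* X) := by
  intro b w
  have hout : ∀ ab' : (Fin d → ℝ) × (Fin m → ℝ), outer ab' * X * P = outer ab' * X := fun ab' => by
    rw [Matrix.mul_assoc, hXP]
  -- The factor `w` need not lie in the row space, but its projection `w P = (w S) X` is attainable,
  -- and projecting does not increase the error.
  have h1 := h (w ᵥ* S, b)
  rw [frobenius_sq_sub_eq_add hPt hPP (hout ab),
    frobenius_sq_sub_eq_add hPt hPP (hout (w ᵥ* S, b))] at h1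
  have h2 : ‖Y * P - outer ab * X‖ ^ 2 ≤ ‖Y * P - outer (w ᵥ* S, b) * X‖ ^ 2 := by linarith
  rw [← outer_mul]
  refine (le_of_sq_le_sq h2 (norm_nonneg _)).trans ?_
  have h3 : Y * P - outer (w ᵥ* S, b) * X = (Y * P - vecMulVec b w) * P := by
    rw [outer_mul, Matrix.sub_mul, Matrix.mul_assoc Y, hPP, vecMulVec_mul, vecMul_vecMul, ← hS]
  rw [h3]
  simpa using frobenius_mul_le_right (Y * P - vecMulVec b w) P zero_le_one hP

theorem deflated_eq (rank1 : ℕ → Rank1Routine m d n) (X : Matrix (Fin d) (Fin n) ℝ) (t : ℕ)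
    (Y : Matrix (Fin m) (Fin n) ℝ) (k : ℕ) :
    deflated rank1 X t Y k = Y - (∑ l ∈ Finset.range k, outer (output rank1 X t Y l)) * X := by
  induction k with
  | zero => simp [deflated]
  | succ k ih =>
    rw [Finset.sum_range_succ, Matrix.add_mul, ← sub_sub, ← ih]
    rfl

theorem sum_sv_shift_le {W : Matrix (Fin m) (Fin d) ℝ} (r N : ℕ) :
    ∑ i ∈ Finset.range N, sv W (r + i) ≤ ∑ k ∈ Finset.Ico r W.rank, sv W k := by
  have h1 : ∑ i ∈ Finset.range N, sv W (r + i) = ∑ k ∈ Finset.Ico r (r + N), sv W k := by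
    rw [Finset.sum_Ico_eq_sum_range, Nat.add_sub_cancel_left]
  rw [h1]
  calc _ ≤ ∑ k ∈ Finset.Ico r (max (r + N) W.rank), sv W k :=
        Finset.sum_le_sum_of_subset_of_nonneg (Finset.Ico_subset_Ico_right (le_max_left _ _))
          fun i _ _ => sv_nonneg _ _
    _ = _ := by
        refine (Finset.sum_subset (Finset.Ico_subset_Ico_right (le_max_right _ _))
          fun i hi hi' => sv_eq_zero_of_rank_le W ?_).symm
        simp only [Finset.mem_Ico] at hi hi'
        omega

/-- The error bound of the sequential algorithm for a noise matrix of operator norm at most `η`. -/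
theorem frobenius_sub_sum_outer_le {X : Matrix (Fin d) (Fin n) ℝ} (hX : 0 < sigmaMin X)
    (W : Matrix (Fin m) (Fin d) ℝ) {E Y : Matrix (Fin m) (Fin n) ℝ} {η : ℝ} (hη : 0 ≤ η)
    (hE : ∀ x, ‖E.toEuclideanLin x‖ ≤ η * ‖x‖) (hY : Y = W * X + E) {r : ℕ} (hr : 1 ≤ r)
    (rank1 : ℕ → Rank1Routine m d n) (t : ℕ) (exact : ℕ → (Fin d → ℝ) × (Fin m → ℝ))
    (hexact : ∀ k < r, IsExactRank1 X (deflated rank1 X t Y k) (exact k))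
    {e : ℕ → ℝ} (he : ∀ k, e k = ‖outer (output rank1 X t Y k) - outer (exact k)‖) :
    ‖W - ∑ k ∈ Finset.range r, outer (output rank1 X t Y k)‖ ≤
      cond X * (∑ k ∈ Finset.Ico r W.rank, sv W k + (∑ l ∈ Finset.range r, e l +
        7 * ∑ k ∈ Finset.range r, ∑ l ∈ Finset.range k, e l)) + 10 * r * η / sigmaMin X := by
  obtain ⟨J, hJ, hJn⟩ := exists_right_inverse hX
  obtain ⟨P, S, hS, hXP, hPt, hPP, hP⟩ := exists_rowspace_projection hX
  set Yk := deflated rank1 X t Y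
  set O := fun k => outer (output rank1 X t Y k)
  have hcomp : ∀ k, ∃ (Q : Matrix (Fin m) (Fin m) ℝ) (Q' : Matrix (Fin n) (Fin n) ℝ), k < r →
      (∀ x, ‖Q.toEuclideanLin x‖ ≤ 1 * ‖x‖) ∧ (∀ x, ‖Q'.toEuclideanLin x‖ ≤ 1 * ‖x‖) ∧
      (1 - Q).rank ≤ 1 ∧ (1 - Q').rank ≤ 1 ∧
      Yk k * P - outer (exact k) * X = Q * (Yk k * P) * Q' ∧
      ∀ i, sv (Yk k * P - outer (exact k) * X) i ≤ sv (Yk k * P) (i + 1) := by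
    intro k
    by_cases hk : k < r
    · obtain ⟨Q, Q', h⟩ :=
        ((hexact k hk).isBestRankOne hS hXP hPt hPP hP).exists_compression
      rw [← outer_mul] at h
      exact ⟨Q, Q', fun _ => h⟩
    · exact ⟨1, 1, fun h => absurd h hk⟩
  choose Q Q' hQ using hcomp
  have hmain := frobenius_inexact_deflation_le (M := W * X) (E := E * P)
    (A := fun k => Yk k * P) (Δ := fun k => (O k - outer (exact k)) * X) (Q := Q) (Q' := Q')
    hr hη (fun x => by
      rw [toEuclideanLin_mul, LinearMap.comp_apply]
      have := hP x
      rw [one_mul] at this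
      exact (hE _).trans (by gcongr))
    (by
      change Y * P = _
      rw [hY, Matrix.add_mul, Matrix.mul_assoc, hXP])
    (fun k hk => (hQ k hk).1) (fun k hk => (hQ k hk).2.1) (fun k hk => (hQ k hk).2.2.1)
    (fun k hk => (hQ k hk).2.2.2.1)
    (fun k hk => by
      rw [← (hQ k hk).2.2.2.2.1]
      change (Yk k - O k * X) * P = _
      rw [Matrix.sub_mul, Matrix.sub_mul, Matrix.mul_assoc (O k), hXP]
      abel)
    (fun k hk i => by
      rw [← (hQ k hk).2.2.2.2.1]
      exact (hQ k hk).2.2.2.2.2 i)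
  set D := W - ∑ k ∈ Finset.range r, O k
  have hD : Yk r * P - E * P = D * X := by
    have hYk : Yk r - E = D * X := by
      rw [Matrix.sub_mul, sub_eq_iff_eq_add, sub_add_eq_add_sub, ← hY]
      exact deflated_eq rank1 X t Y r
    rw [← Matrix.sub_mul, hYk, Matrix.mul_assoc, hXP]
  simp only [hD] at hmain
  have hmax : 0 ≤ sigmaMax X := sv_nonneg _ _
  have hΔ : ∀ k, ‖(O k - outer (exact k)) * X‖ ≤ sigmaMax X * e k := fun k => by
    rw [he]
    exact frobenius_mul_le_right _ X hmax (norm_toEuclideanLin_le_sigmaMax X)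
  have hτ : ∑ i ∈ Finset.range n, sv (W * X) (r + i) ≤
      sigmaMax X * ∑ k ∈ Finset.Ico r W.rank, sv W k := by
    refine le_trans ?_ (mul_le_mul_of_nonneg_left (sum_sv_shift_le r n) hmax)
    rw [Finset.mul_sum]
    exact Finset.sum_le_sum fun i _ =>
      sv_mul_le_right W X _ hmax (norm_toEuclideanLin_le_sigmaMax X)
  have hsum : ∀ k, ∑ l ∈ Finset.range k, ‖(O l - outer (exact l)) * X‖ ≤
      sigmaMax X * ∑ l ∈ Finset.range k, e l := fun k => by
    rw [Finset.mul_sum]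
    exact Finset.sum_le_sum fun l _ => hΔ l
  have hsum2 : ∑ k ∈ Finset.range r, ∑ l ∈ Finset.range k, ‖(O l - outer (exact l)) * X‖ ≤
      sigmaMax X * ∑ k ∈ Finset.range r, ∑ l ∈ Finset.range k, e l := by
    rw [Finset.mul_sum]
    exact Finset.sum_le_sum fun k _ => hsum k
  have hDX : ‖D‖ ≤ (sigmaMin X)⁻¹ * ‖D * X‖ := by
    have := frobenius_mul_le_right (D * X) J (inv_nonneg.2 hX.le) hJn
    rwa [Matrix.mul_assoc, hJ, Matrix.mul_one] at this
  refine hDX.trans ?_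
  rw [inv_mul_eq_div, cond, div_mul_eq_mul_div, ← add_div]
  gcongr
  have := hsum r
  linarith

theorem gap_le_sv (Y : Matrix (Fin m) (Fin n) ℝ) {j k : ℕ} (hjk : j ≤ k) : gap Y k ≤ sv Y j :=
  (min_le_right _ _).trans (sv_antitone Y hjk)

theorem gap_pos_of_gapMin_pos {Y : Matrix (Fin m) (Fin n) ℝ} {r : ℕ} (h : 0 < gapMin Y r) {k : ℕ}
    (hk : k < r) : 0 < gap Y k :=
  h.trans_le (ciInf_le (Set.finite_range _).bddBelow (⟨k, hk⟩ : Fin r))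

/-- For `j ≤ k` the gap at `k` is at most `σ_k ≤ σ_j`, so each factor is at least `8`. The diagonal
terms, with empty product, supply the first sum. -/
theorem le_accumulatedError {Y : Matrix (Fin m) (Fin n) ℝ} {r : ℕ} (h : 0 < gapMin Y r)
    {e : ℕ → ℝ} (he : ∀ k, 0 ≤ e k) :
    ∑ l ∈ Finset.range r, e l + 7 * ∑ k ∈ Finset.range r, ∑ l ∈ Finset.range k, e l ≤
      accumulatedError Y e r := by
  rw [accumulatedError, Finset.mul_sum, ← Finset.sum_add_distrib]
  refine Finset.sum_le_sum fun k hk => ?_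
  have hgap := gap_pos_of_gapMin_pos h (Finset.mem_range.1 hk)
  rw [Finset.sum_range_succ, Finset.Ioc_self, Finset.prod_empty, mul_one, add_comm,
    Finset.mul_sum]
  refine add_le_add_left (Finset.sum_le_sum fun l hl => ?_) _
  rw [mul_comm]
  refine mul_le_mul_of_nonneg_left ?_ (he l)
  have hfac : ∀ j ∈ Finset.Ioc l k, (8 : ℝ) ≤ 2 + 6 * sv Y j / gap Y k := by
    intro j hj
    have h1 := gap_le_sv Y (Finset.mem_Ioc.1 hj).2
    have : 6 ≤ 6 * sv Y j / gap Y k := by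
      rw [le_div_iff₀ hgap]; linarith
    linarith
  calc (7 : ℝ) ≤ 8 ^ 1 := by norm_num
    _ ≤ 8 ^ (Finset.Ioc l k).card := by
      refine pow_le_pow_right₀ (by norm_num) ?_
      rw [Nat.card_Ioc]
      have := Finset.mem_range.1 hl
      omega
    _ = ∏ _j ∈ Finset.Ioc l k, (8 : ℝ) := by rw [Finset.prod_const]
    _ ≤ _ := Finset.prod_le_prod (fun _ _ => by norm_num) hfac

end SeqLowRank

/-! ### Operator norm of a Gaussian matrix by nets and a union bound. -/

namespace SeqLowRank

open Module Matrix

/-- The ball of radius two has a `1`-net of cardinality at most `5 ^ dim`. -/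
theorem exists_net (E : Type*) [NormedAddCommGroup E] [NormedSpace ℝ E] [FiniteDimensional ℝ E] :
    ∃ s : Finset E, s.card ≤ 5 ^ finrank ℝ E ∧ (∀ c ∈ s, ‖c‖ ≤ 2) ∧
      ∀ x, ‖x‖ ≤ 2 → ∃ c ∈ s, ‖x - c‖ ≤ 1 := by
  classical
  let S : Set ℕ := {k | ∃ s : Finset E, (∀ c ∈ s, ‖c‖ ≤ 2) ∧
    (∀ c ∈ s, ∀ d ∈ s, c ≠ d → 1 ≤ ‖c - d‖) ∧ s.card = k}
  have hbdd : BddAbove S := by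
    refine ⟨5 ^ finrank ℝ E, ?_⟩
    rintro _ ⟨s, h1, h2, rfl⟩
    exact Besicovitch.card_le_of_separated s h1 h2
  obtain ⟨s, h1, h2, h3⟩ := Nat.sSup_mem (s := S) ⟨0, ∅, by simp⟩ hbdd
  refine ⟨s, Besicovitch.card_le_of_separated s h1 h2, h1, fun x hx => ?_⟩
  by_contra! hcon
  have hxs : x ∉ s := fun h => by have := hcon x h; simp at this; linarith
  have hmem : (insert x s).card ∈ S := by
    refine ⟨insert x s, ?_, ?_, rfl⟩
    · intro c hc
      rcases Finset.mem_insert.1 hc with rfl | hc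
      exacts [hx, h1 c hc]
    · intro c hc d hd hcd
      rcases Finset.mem_insert.1 hc with hc' | hc' <;>
        rcases Finset.mem_insert.1 hd with hd' | hd'
      · exact absurd (hc'.trans hd'.symm) hcd
      · rw [hc']; exact (hcon d hd').le
      · rw [hd', norm_sub_rev]; exact (hcon c hc').le
      · exact h2 c hc' d hd' hcd
  have := le_csSup hbdd hmem
  rw [Finset.card_insert_of_notMem hxs] at this
  omega

/-- Taking radius two and mesh one loses no constant: a net point near `2 T v / ‖T v‖` gives `‖T v‖
≤ t`, and then `2 ‖T‖ ≤ t + ‖T‖`. -/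
theorem norm_apply_le_of_net {E F : Type*} [NormedAddCommGroup E] [InnerProductSpace ℝ E]
    [FiniteDimensional ℝ E] [NormedAddCommGroup F] [InnerProductSpace ℝ F] {s : Set E} {s' : Set F}
    (hs : ∀ x, ‖x‖ ≤ 2 → ∃ c ∈ s, ‖x - c‖ ≤ 1) (hs' : ∀ x, ‖x‖ ≤ 2 → ∃ c ∈ s', ‖x - c‖ ≤ 1)
    (T : E →ₗ[ℝ] F) {t : ℝ} (ht : 0 ≤ t) (h : ∀ v ∈ s, ∀ u ∈ s', inner ℝ u (T v) ≤ t) (x : E) :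
    ‖T x‖ ≤ t * ‖x‖ := by
  set T' := T.toContinuousLinearMap
  have hT' : ∀ x, T' x = T x := fun _ => rfl
  have h1 : ∀ v ∈ s, ‖T v‖ ≤ t := by
    intro v hv
    rcases (norm_nonneg (T v)).eq_or_lt with h0 | h0
    · rwa [← h0]
    obtain ⟨u, hu, hzu⟩ := hs' ((2 / ‖T v‖) • T v) (by
      rw [norm_smul, Real.norm_of_nonneg (by positivity), div_mul_cancel₀ _ h0.ne'])
    have h2 := real_inner_le_norm ((2 / ‖T v‖) • T v - u) (T v)
    rw [inner_sub_left, inner_smul_left, real_inner_self_eq_norm_sq] at h2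
    have h3 : (starRingEnd ℝ) (2 / ‖T v‖) * ‖T v‖ ^ 2 = 2 * ‖T v‖ := by
      rw [conj_trivial]; field_simp
    have h4 := h v hv u hu
    have h5 := mul_le_mul_of_nonneg_right hzu h0.le
    linarith
  have hK : ‖T'‖ ≤ (t + ‖T'‖) / 2 := by
    refine T'.opNorm_le_bound (by positivity) fun x => ?_
    rcases (norm_nonneg x).eq_or_lt with h0 | h0
    · rw [norm_eq_zero.1 h0.symm]; simp
    obtain ⟨c, hc, hzc⟩ := hs ((2 / ‖x‖) • x) (by
      rw [norm_smul, Real.norm_of_nonneg (by positivity), div_mul_cancel₀ _ h0.ne'])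
    have h2 : ‖T' ((2 / ‖x‖) • x)‖ ≤ t + ‖T'‖ := by
      have h3 : T' ((2 / ‖x‖) • x) = T' c + T' ((2 / ‖x‖) • x - c) := by
        rw [← map_add, add_sub_cancel]
      rw [h3]
      refine (norm_add_le _ _).trans (add_le_add (h1 c hc) ?_)
      exact (T'.le_opNorm _).trans (mul_le_of_le_one_right (norm_nonneg _) hzc)
    rw [map_smul, norm_smul, Real.norm_of_nonneg (by positivity), div_mul_eq_mul_div,
      div_le_iff₀ h0] at h2
    linarith
  have := T'.le_opNorm x
  rw [hT'] at this
  exact this.trans (mul_le_mul_of_nonneg_right (by linarith) (norm_nonneg x))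

section noise

variable {m n : ℕ} {Ω : Type*} [MeasurableSpace Ω] {μ : Measure Ω}
  {E : Ω → Matrix (Fin m) (Fin n) ℝ} {ε : ℝ≥0}

theorem hasSubgaussianMGF_of_hasLaw_gaussianReal {X : Ω → ℝ} {v : ℝ≥0}
    (h : HasLaw X (gaussianReal 0 v) μ) : HasSubgaussianMGF X v μ := by
  rw [← HasSubgaussianMGF.id_map_iff h.aemeasurable, h.map_eq]
  exact ⟨fun t => integrable_exp_mul_gaussianReal t, fun t => by
    rw [mgf_id_gaussianReal]; simp⟩

theorem hasSubgaussianMGF_const_mul {X : Ω → ℝ} {v : ℝ≥0} (h : HasSubgaussianMGF X v μ) (a : ℝ) :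
    HasSubgaussianMGF (fun ω => a * X ω) (‖a‖₊ ^ 2 * v) μ := by
  refine ⟨(h.const_mul a).integrable_exp_mul, fun t => ?_⟩
  rw [mgf_const_mul]
  refine (h.mgf_le (a * t)).trans_eq ?_
  rw [NNReal.coe_mul, NNReal.coe_pow, coe_nnnorm, Real.norm_eq_abs, sq_abs]
  congr 1
  ring

theorem hasSubgaussianMGF_inner_apply
    (hlaw : ∀ i j, HasLaw (fun ω => E ω i j) (gaussianReal 0 (ε ^ 2)) μ)
    (hind : iIndepFun (fun (p : Fin m × Fin n) (ω : Ω) => E ω p.1 p.2) μ)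
    {u : EuclideanSpace ℝ (Fin m)} {v : EuclideanSpace ℝ (Fin n)} (hu : ‖u‖ ≤ 2) (hv : ‖v‖ ≤ 2) :
    HasSubgaussianMGF (fun ω => inner ℝ u ((E ω).toEuclideanLin v)) (16 * ε ^ 2) μ := by
  have hind' := hind.comp (fun p x => (u.ofLp p.1 * v.ofLp p.2) * x)
    (fun p => measurable_const_mul _)
  have hsub : ∀ p : Fin m × Fin n, HasSubgaussianMGF
      ((fun x => (u.ofLp p.1 * v.ofLp p.2) * x) ∘ fun ω => E ω p.1 p.2)
      (‖u.ofLp p.1 * v.ofLp p.2‖₊ ^ 2 * ε ^ 2) μ := fun p =>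
    hasSubgaussianMGF_const_mul (hasSubgaussianMGF_of_hasLaw_gaussianReal (hlaw p.1 p.2)) _
  have hsum := HasSubgaussianMGF.sum_of_iIndepFun hind' (s := Finset.univ) fun p _ => hsub p
  have hfun : (fun ω => inner ℝ u ((E ω).toEuclideanLin v)) =
      fun ω => ∑ p : Fin m × Fin n,
        ((fun x => (u.ofLp p.1 * v.ofLp p.2) * x) ∘ fun ω => E ω p.1 p.2) ω := by
    ext ω
    rw [euclidean_inner, Fintype.sum_prod_type]
    simp only [toLpLin_apply, dotProduct, mulVec, Function.comp_apply, Finset.mul_sum]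
    exact Finset.sum_congr rfl fun i _ => Finset.sum_congr rfl fun j _ => by ring
  rw [hfun]
  refine ⟨hsum.integrable_exp_mul, fun t => (hsum.mgf_le t).trans ?_⟩
  gcongr
  rw [← Finset.sum_mul]
  gcongr
  rw [← NNReal.coe_le_coe]
  have h1 : ∑ p : Fin m × Fin n, (u.ofLp p.1 * v.ofLp p.2) ^ 2 = ‖u‖ ^ 2 * ‖v‖ ^ 2 := by
    rw [EuclideanSpace.real_norm_sq_eq, EuclideanSpace.real_norm_sq_eq, Finset.sum_mul_sum,
      Fintype.sum_prod_type]
    simp only [mul_pow]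
  push_cast
  simp only [Real.norm_eq_abs, sq_abs]
  refine h1.trans_le ?_
  calc ‖u‖ ^ 2 * ‖v‖ ^ 2 ≤ 2 ^ 2 * 2 ^ 2 := by gcongr
    _ = 16 := by norm_num

/-- A Gaussian matrix has operator norm of order `ε √(n L)` outside of an event of probability at
most `exp (-L)`. -/
theorem exists_gaussian_opNorm_event [IsProbabilityMeasure μ] (hmn : m ≤ n) (hn : 1 ≤ n)
    (hlaw : ∀ i j, HasLaw (fun ω => E ω i j) (gaussianReal 0 (ε ^ 2)) μ)
    (hind : iIndepFun (fun (p : Fin m × Fin n) (ω : Ω) => E ω p.1 p.2) μ) {L₀ L : ℝ}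
    (hL₀ : 0 < L₀) (hL : L₀ ≤ L) :
    ∃ B : Set Ω, μ.real B ≤ Real.exp (-L) ∧ ∀ ω ∉ B, ∀ x, ‖(E ω).toEuclideanLin x‖ ≤
      √(32 * (1 + 8 / L₀)) * (ε * √(n * L)) * ‖x‖ := by
  rcases eq_or_ne ε 0 with rfl | hε
  · refine ⟨{ω | ¬ E ω = 0}, ?_, fun ω hω x => ?_⟩
    · have h1 : ∀ᵐ ω ∂μ, ∀ i j, E ω i j = 0 := by
        refine ae_all_iff.2 fun i => ae_all_iff.2 fun j => ?_
        have := hasSubgaussianMGF_of_hasLaw_gaussianReal (hlaw i j)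
        rw [zero_pow two_ne_zero] at this
        exact this.ae_eq_zero_of_hasSubgaussianMGF_zero
      have h2 : μ {ω | ¬ E ω = 0} = 0 := by
        rw [← ae_iff]
        filter_upwards [h1] with ω hω
        ext i j
        exact hω i j
      rw [Measure.real, h2]
      simp [Real.exp_nonneg]
    · rw [not_not.1 hω]
      simp
  obtain ⟨s, hsc, hs2, hs⟩ := exists_net (EuclideanSpace ℝ (Fin n))
  obtain ⟨s', hsc', hs2', hs'⟩ := exists_net (EuclideanSpace ℝ (Fin m))
  have hLpos : 0 < L := hL₀.trans_le hL
  -- Chosen so that the tail exponent `t² / (32 ε²)` is `n L + 8 n L / L₀`, at least `L + 8 n`; the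
  -- excess `8 n` pays for the `5 ^ (n + m)` pairs of net points.
  set t := √(32 * (1 + 8 / L₀)) * (ε * √(n * L))
  have ht : 0 ≤ t := by positivity
  have ht2 : t ^ 2 = 32 * (1 + 8 / L₀) * (ε ^ 2 * (n * L)) := by
    rw [mul_pow, mul_pow, Real.sq_sqrt (by positivity), Real.sq_sqrt (by positivity)]
  refine ⟨⋃ p ∈ s ×ˢ s', {ω | t ≤ inner ℝ p.2 ((E ω).toEuclideanLin p.1)}, ?_, fun ω hω x => ?_⟩
  · have hn' : (1 : ℝ) ≤ n := by exact_mod_cast hn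
    have hε' : (0 : ℝ) < ε := by positivity
    have htail : ∀ p ∈ s ×ˢ s', μ.real {ω | t ≤ inner ℝ p.2 ((E ω).toEuclideanLin p.1)} ≤
        Real.exp (-(L + 8 * n)) := by
      intro p hp
      rw [Finset.mem_product] at hp
      refine ((hasSubgaussianMGF_inner_apply hlaw hind (hs2' _ hp.2) (hs2 _ hp.1)).measure_ge_le
        ht).trans (Real.exp_le_exp.2 ?_)
      rw [neg_div, neg_le_neg_iff, ht2]
      push_cast
      have h1 : 32 * (1 + 8 / L₀) * ((ε : ℝ) ^ 2 * (n * L)) / (2 * (16 * (ε : ℝ) ^ 2)) =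
          n * L + 8 * (n * (L / L₀)) := by
        field_simp
        norm_num
      rw [h1]
      have h2 : 1 ≤ L / L₀ := (one_le_div hL₀).2 hL
      nlinarith
    refine (measureReal_biUnion_finset_le _ _).trans ((Finset.sum_le_sum htail).trans ?_)
    rw [Finset.sum_const, nsmul_eq_mul, Finset.card_product]
    have hcard : ((s.card * s'.card : ℕ) : ℝ) ≤ Real.exp (8 * n) := by
      have h1 : s.card * s'.card ≤ 5 ^ (2 * n) := by
        rw [finrank_euclideanSpace_fin] at hsc hsc'
        calc s.card * s'.card ≤ 5 ^ n * 5 ^ m := Nat.mul_le_mul hsc hsc'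
          _ = 5 ^ (n + m) := (pow_add _ _ _).symm
          _ ≤ 5 ^ (2 * n) := Nat.pow_le_pow_right (by norm_num) (by omega)
      calc ((s.card * s'.card : ℕ) : ℝ) ≤ ((5 ^ (2 * n) : ℕ) : ℝ) := by exact_mod_cast h1
        _ = (5 : ℝ) ^ (2 * n) := by push_cast; rfl
        _ ≤ (Real.exp 4) ^ (2 * n) := by
          gcongr
          have := Real.add_one_le_exp (4 : ℝ)
          linarith
        _ = Real.exp (8 * n) := by
          rw [← Real.exp_nat_mul]; congr 1; push_cast; ring
    calc _ ≤ Real.exp (8 * n) * Real.exp (-(L + 8 * n)) := by gcongr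
      _ = Real.exp (-L) := by rw [← Real.exp_add]; congr 1; ring
  · refine norm_apply_le_of_net (s := s) (s' := s') hs hs' _ ht (fun v hv u hu => ?_) x
    by_contra hlt
    refine hω (Set.mem_biUnion (x := (v, u)) (Finset.mem_coe.2 (Finset.mem_product.2 ⟨hv, hu⟩)) ?_)
    exact (not_le.1 hlt).le

end noise

end SeqLowRank

/-! ### The probabilistic statement. -/

theorem theorem3 :
    ∃ c : ℝ, 0 < c ∧ ∀ γ₀ : ℝ, γ₀ < 1 → ∃ C : ℝ, 0 < C ∧
      ∀ (m d n r : ℕ) (X : Matrix (Fin d) (Fin n) ℝ) (Wstar : Matrix (Fin m) (Fin d) ℝ)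
        (ε : ℝ≥0) (γ : ℝ),
        m ≤ n → 1 ≤ r → 0 < SeqLowRank.sigmaMin X → 0 < γ → γ ≤ γ₀ →
      ∀ (Ω : Type*) [MeasurableSpace Ω] (μ : Measure Ω) [IsProbabilityMeasure μ]
        (E : Ω → Matrix (Fin m) (Fin n) ℝ),
        (∀ i j, HasLaw (fun ω => E ω i j) (gaussianReal 0 (ε ^ 2)) μ) →
        iIndepFun (fun (p : Fin m × Fin n) (ω : Ω) => E ω p.1 p.2) μ →
      ∃ G : Set Ω, MeasurableSet G ∧ 1 - γ ≤ μ.real G ∧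
        ∀ ω ∈ G, ∀ Y : Matrix (Fin m) (Fin n) ℝ, Y = Wstar * X + E ω →
          0 < SeqLowRank.gapMin Y r →
          (ε : ℝ) ≤ c * (SeqLowRank.gapMin Y r / (√(n : ℝ) + √(Real.log (1 / γ)))) →
          ∀ (rank1 : ℕ → SeqLowRank.Rank1Routine m d n) (t : ℕ)
            (exact : ℕ → (Fin d → ℝ) × (Fin m → ℝ)),
            (∀ k < r, SeqLowRank.IsExactRank1 X (SeqLowRank.deflated rank1 X t Y k) (exact k)) →
            ‖Wstar - ∑ k ∈ Finset.range r, SeqLowRank.outer (SeqLowRank.output rank1 X t Y k)‖ ≤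
              SeqLowRank.cond X *
                (∑ k ∈ Finset.Ico r Wstar.rank, SeqLowRank.sv Wstar k +
                  SeqLowRank.accumulatedError Y
                    (fun k => ‖SeqLowRank.outer (SeqLowRank.output rank1 X t Y k) -
                      SeqLowRank.outer (exact k)‖) r) +
              C * ((ε : ℝ) * √((n : ℝ) * Real.log (1 / γ)) / SeqLowRank.sigmaMin X *
                ((r : ℝ) + √(((min Wstar.rank r : ℕ) : ℝ) / SeqLowRank.gapMin Y r))) := by
  refine ⟨1, one_pos, fun γ₀ hγ₀ => ?_⟩
  rcases le_or_gt γ₀ 0 with hneg | hpos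
  · refine ⟨1, one_pos, ?_⟩
    intro m d n r X Wstar ε γ _ _ _ hγ hγγ₀
    exact absurd hγ (not_lt.2 (hγγ₀.trans hneg))
  -- Here `γ₀ < 1` enters: `log (1/γ)` stays away from zero, so it can absorb the dimensional cost
  -- of the net.
  have hL₀ : 0 < Real.log (1 / γ₀) := Real.log_pos ((one_lt_div hpos).2 hγ₀)
  set K := √(32 * (1 + 8 / Real.log (1 / γ₀)))
  have hK : 0 < K := by positivity
  refine ⟨10 * K, by positivity, ?_⟩
  intro m d n r X Wstar ε γ hmn hr hX hγ hγγ₀ Ω _ μ _ E hlaw hind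
  have hL : Real.log (1 / γ₀) ≤ Real.log (1 / γ) :=
    Real.log_le_log (by positivity) (one_div_le_one_div_of_le hγ hγγ₀)
  have hn : 1 ≤ n := by
    have h1 := (LinearMap.singularValues_pos_iff_lt_finrank_range _).1 hX
    have h2 := h1.trans_le (LinearMap.finrank_range_le _)
    rw [finrank_euclideanSpace_fin] at h2
    omega
  obtain ⟨B, hB, hnorm⟩ := SeqLowRank.exists_gaussian_opNorm_event hmn hn hlaw hind hL₀ hL
  -- The exceptional set need not be measurable; its measurable hull has the same measure.
  refine ⟨(toMeasurable μ B)ᶜ, (measurableSet_toMeasurable μ B).compl, ?_, ?_⟩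
  · rw [probReal_compl_eq_one_sub (measurableSet_toMeasurable μ B), measureReal_def,
      measure_toMeasurable, ← measureReal_def]
    rw [one_div, Real.log_inv, neg_neg, Real.exp_log hγ] at hB
    linarith
  intro ω hω Y hY hgap _ rank1 t exact hexact
  have hη := hnorm ω fun h => hω (subset_toMeasurable μ B h)
  refine (SeqLowRank.frobenius_sub_sum_outer_le hX Wstar (by positivity) hη hY hr rank1 t exact
    hexact fun _ => rfl).trans (add_le_add ?_ ?_)
  · refine mul_le_mul_of_nonneg_left (add_le_add le_rfl ?_)
      (div_nonneg (SeqLowRank.sv_nonneg _ _) hX.le)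
    exact SeqLowRank.le_accumulatedError hgap fun _ => norm_nonneg _
  -- The noise contributes a multiple of `r` alone; the square-root summand is added as a
  -- nonnegative term.
  · calc 10 * (r : ℝ) * (K * (ε * √(n * Real.log (1 / γ)))) / SeqLowRank.sigmaMin X =
        10 * K * (ε * √(n * Real.log (1 / γ)) / SeqLowRank.sigmaMin X * r) := by ring
      _ ≤ _ := by
        gcongr
        exact le_add_of_nonneg_right (Real.sqrt_nonneg _)
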